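/- **Lemma (Consistency).** Let $d\in\{2,3\}$, $T>0$, $J=(0,T]$. Let $\Omega\subset\mathbb R^d$ be a polygonal/polyhedral domain partitioned into two disjoint polygonal/polyhedral subdomains $\Omega^s,\Omega^b$ (each of the three sets is open and equal to the interior of its closure), with interface $\Gamma_I=\partial\Omega^s\cap\partial\Omega^b$ and outer boundary pieces $\Gamma^j=\partial\Omega\cap\partial\Omega^j$, $j=s,b$. Let $\Gamma^j=\Gamma^j_D\cup\Gamma^j_N$ ($j=s,b$) and $\Gamma^b=\Gamma^b_P\cup\Gamma^b_F$ be partitions into disjoint sets. Let $n,n^j$ be the unit outward normals to $\Omega,\Omega^j$; on $\Gamma_I$ put $n=n^s=-n^b$. Let $\mu^s,\mu^b,\kappa,\gamma>0$, $\lambda\ne0$, $0<\alpha<1$, $c_0\ge0$ be constants and $\beta^s,\beta^b\in\mathbb R$. Write $\varepsilon(w)=\frac12(\nabla w+(\nabla w)^T)$, $\sigma^j=2\mu^j\varepsilon(u^j)-p^j\mathbb I$, $w^t=w-(w\cdot n)n$. *Continuous problem.* Let $u^j,p^j$ on $\overline{\Omega^j}\times J$ ($j=s,b$) and $z,p^p$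 on $\overline{\Omega^b}\times J$ be a smooth solution (for each $t\in J$: $u^j(t)\in C^2(\overline{\Omega^j})^d$, $p^j(t)\in C^1(\overline{\Omega^j})$, $z(t)\in C^1(\overline{\Omega^b})^d$, $p^p(t)\in C^1(\overline{\Omega^b})$, and $\partial_tu^b,\partial_tp^b,\partial_tp^p$ exist pointwise on $\overline{\Omega^b}$, one-sided at $t=T$, and are continuous in $x\in\overline{\Omega^b}$) of $$-\nabla\cdot\sigma^j=f^j\ \text{ in }\Omega^j\times J,\ j=s,b,\qquad -\nabla\cdot u^s=0\ \text{ in }\Omega^s\times J,$$ and, in $\Omega^b\times J$, $$-\nabla\cdot u^b+\lambda^{-1}(\alpha p^p-p^b)=0,\quad c_0\partial_tp^p+\alpha\lambda^{-1}(\alpha\partial_tp^p-\partial_tp^b)+\nabla\cdot z=g^b,\quad \kappa^{-1}z+\nabla p^p=0,$$ with the interface conditions on $\Gamma_I\times J$ $$u^s\cdot n=(\partial_tu^b+z)\cdot n,\quad \sigma^sn=\sigma^bn,\quad -(\sigma^sn)\cdot n=p^p,\quad -2\mu^s(\varepsilon(u^s)n)^t=\gamma(\mu^s/\kappa)^{1/2}(u^s-\partial_tu^b)^t$$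 and the boundary conditions on $J$: $u^j=0$ on $\Gamma^j_D$, $\sigma^jn=0$ on $\Gamma^j_N$ ($j=s,b$), $p^p=0$ on $\Gamma^b_P$, $z\cdot n=0$ on $\Gamma^b_F$. (Conditions that involve normals are imposed at the points where the boundary is locally flat.) *Discretization.* Let $\mathcal T^j$ be a finite conforming triangulation of $\Omega^j$ into nondegenerate $d$-simplices, $j=s,b$, such that $\mathcal T=\mathcal T^s\cup\mathcal T^b$ is a conforming triangulation of $\Omega$, and such that every facet on $\Gamma^j$ lies, up to a set of zero $(d-1)$-dimensional measure, on $\Gamma^j_D$ or on $\Gamma^j_N$, and every facet on $\Gamma^b$ on $\Gamma^b_P$ or on $\Gamma^b_F$. Let $\mathcal F^j$ be the set of facets of elements of $\mathcal T^j$, $\Gamma_0^j$ the union of these facets, and $\mathcal F_I$ the set of facets on $\Gamma_I$. Let $k\ge1$ and $$V_h=\prod_{K\in\mathcal T}[P_k(K)]^d,\quad V_h^b=\prod_{K\in\mathcal T^b}[P_k(K)]^d,\quad Q_h=\prod_{K\in\mathcal T}P_{k-1}(K),\quad Q_h^b=\prod_{K\in\mathcal T^b}P_{k-1}(K),$$ $$\bar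 V_h^j=\Big\{\bar v\in\prod_{F\in\mathcal F^j}[P_k(F)]^d:\bar v=0\text{ on facets on }\Gamma_D^j\Big\},\quad \bar Q_h^j=\prod_{F\in\mathcal F^j}P_k(F),\quad \bar Q_h^{b0}=\{\bar q\in\bar Q_h^b:\bar q=0\text{ on facets on }\Gamma_P^b\}.$$ Write $(\cdot,\cdot)_{\Omega^j}=\sum_{K\in\mathcal T^j}(\cdot,\cdot)_{L^2(K)}$, $(\cdot,\cdot)_\Omega=(\cdot,\cdot)_{\Omega^s}+(\cdot,\cdot)_{\Omega^b}$, $\langle\cdot,\cdot\rangle_{\partial\mathcal T^j}=\sum_{K\in\mathcal T^j}\langle\cdot,\cdot\rangle_{L^2(\partial K)}$, $\langle\cdot,\cdot\rangle_{\Gamma_I}=\sum_{F\in\mathcal F_I}\langle\cdot,\cdot\rangle_{L^2(F)}$. With $h_K=\operatorname{diam}K$, and with $n^j$ on $\partial K$ denoting the unit outward normal to $K\in\mathcal T^j$, define for $\boldsymbol v=(v,\bar v^s,\bar v^b)$, $\boldsymbol q=(q,\bar q^s,\bar q^b)$, $\boldsymbol v^j=(v,\bar v^j)$, $\boldsymbol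 q^j=(q,\bar q^j)$: $$a_h^j(\boldsymbol u^j,\boldsymbol v^j)=(2\mu^j\varepsilon(u),\varepsilon(v))_{\Omega^j}+\sum_{K\in\mathcal T^j}\langle2\beta^j\mu^jh_K^{-1}(u-\bar u^j),v-\bar v^j\rangle_{\partial K}-\langle2\mu^j\varepsilon(u)n^j,v-\bar v^j\rangle_{\partial\mathcal T^j}-\langle2\mu^j\varepsilon(v)n^j,u-\bar u^j\rangle_{\partial\mathcal T^j},$$ $$b_h^j(\boldsymbol q^j,\boldsymbol v^j)=-(q,\nabla\cdot v)_{\Omega^j}+\langle\bar q^j,(v-\bar v^j)\cdot n^j\rangle_{\partial\mathcal T^j},\qquad a_h=a_h^s+a_h^b,\quad b_h=b_h^s+b_h^b,$$ $$c_h((p,r),q)=(\lambda^{-1}(\alpha p-r),q)_{\Omega^b},\qquad b_h^I(\bar q,(\bar v^s,\bar v^b))=\langle\bar q,(\bar v^s-\bar v^b)\cdot n\rangle_{\Gamma_I},$$ $$a_h^I((\bar u^s,\bar u^b),(\bar v^s,\bar v^b))=\langle\gamma(\mu^s/\kappa)^{1/2}(\bar u^s-\bar u^b)^t,(\bar v^s-\bar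 v^b)^t\rangle_{\Gamma_I}.$$ *Claim.* Let $u,p,f$ be the functions on $\Omega$ with $u|_{\Omega^j}=u^j$, $p|_{\Omega^j}=p^j$, $f|_{\Omega^j}=f^j$, and put $\boldsymbol u=(u,u^s|_{\Gamma_0^s},u^b|_{\Gamma_0^b})$, $\boldsymbol p=(p,p^s|_{\Gamma_0^s},p^b|_{\Gamma_0^b})$, $\boldsymbol p^p=(p^p,p^p|_{\Gamma_0^b})$. Then for all $t\in J$ and all $\boldsymbol v_h=(v_h,\bar v_h^s,\bar v_h^b)\in V_h\times\bar V_h^s\times\bar V_h^b$, $\boldsymbol q_h=(q_h,\bar q_h^s,\bar q_h^b)\in Q_h\times\bar Q_h^s\times\bar Q_h^b$, $w_h\in V_h^b$, $\boldsymbol q_h^p=(q_h^p,\bar q_h^p)\in Q_h^b\times\bar Q_h^{b0}$, where $q_h^b=q_h|_{\Omega^b}$, $$a_h(\boldsymbol u,\boldsymbol v_h)+a_h^I((u^s,\partial_tu^b),(\bar v_h^s,\bar v_h^b))+b_h(\boldsymbol p,\boldsymbol v_h)+b_h^I(p^p,(\bar v_h^s,\bar v_h^b))=(f,v_h)_\Omega,$$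 $$b_h(\boldsymbol q_h,\boldsymbol u)+c_h((p^p,p^b),q_h^b)=0,$$ $$(c_0\partial_tp^p,q_h^p)_{\Omega^b}+c_h((\partial_tp^p,\partial_tp^b),\alpha q_h^p)-b_h^b(\boldsymbol q_h^p,(z,0))-b_h^I(\bar q_h^p,(u^s,\partial_tu^b))=(g^b,q_h^p)_{\Omega^b},$$ $$(\kappa^{-1}z,w_h)_{\Omega^b}+b_h^b(\boldsymbol p^p,(w_h,0))=0.$$ -/

import Mathlib

open MeasureTheory Set
open scoped Classical

noncomputable section

namespace StokesBiot

/-- Points and vectors of `ℝᵈ` with the Euclidean norm. -/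
abbrev Pt (d : ℕ) := EuclideanSpace ℝ (Fin d)

/-- The two subdomains: `s` (Stokes) and `b` (Biot). -/
inductive Side where
  | s
  | b

variable {d : ℕ}

/-! ### Calculus up to the boundary

All spatial derivatives are taken within a set `D` with dense interior (the closure of a subdomain,
or a closed element). At interior points of `D` they are the usual partial derivatives, at boundary
points they are the one-sided ones, i.e. the traces of the derivatives. -/

/-- `∂ᵢ f` at `x`, within `D`. -/
def pd (D : Set (Pt d)) (f : Pt d → ℝ) (i : Fin d) (x : Pt d) : ℝ :=
  fderivWithin ℝ f D x (EuclideanSpace.single i 1)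

/-- `∇ f`. -/
def grad (D : Set (Pt d)) (f : Pt d → ℝ) (x : Pt d) : Pt d :=
  WithLp.toLp 2 fun i => pd D f i x

/-- `∇ · w`. -/
def divg (D : Set (Pt d)) (w : Pt d → Pt d) (x : Pt d) : ℝ :=
  ∑ i, pd D (fun y => w y i) i x

/-- `ε(w) = (∇ w + (∇ w)ᵀ) / 2`. -/
def eps (D : Set (Pt d)) (w : Pt d → Pt d) (x : Pt d) : Matrix (Fin d) (Fin d) ℝ :=
  Matrix.of fun i j => (pd D (fun y => w y i) j x + pd D (fun y => w y j) i x) / 2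

/-- Row-wise divergence of a matrix field. -/
def matDiv (D : Set (Pt d)) (S : Pt d → Matrix (Fin d) (Fin d) ℝ) (x : Pt d) : Pt d :=
  WithLp.toLp 2 fun i => ∑ j, pd D (fun y => S y i j) j x

/-- The matrix-vector product `M n`. -/
def mv (M : Matrix (Fin d) (Fin d) ℝ) (n : Pt d) : Pt d :=
  WithLp.toLp 2 fun i => ∑ j, M i j * n j

/-- The product `A : B`. -/
def frob (A B : Matrix (Fin d) (Fin d) ℝ) : ℝ := ∑ i, ∑ j, A i j * B i j

/-- The stress `σ = 2 μ ε(w) - q I`. -/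
def stress (D : Set (Pt d)) (μ : ℝ) (w : Pt d → Pt d) (q : Pt d → ℝ) (x : Pt d) :
    Matrix (Fin d) (Fin d) ℝ :=
  (2 * μ) • eps D w x - q x • (1 : Matrix (Fin d) (Fin d) ℝ)

/-- The tangential part `wᵗ = w - (w · n) n`. -/
def tang (n w : Pt d) : Pt d := w - (inner ℝ w n) • n

/-- The time derivative at `t` on the time interval `J = (0, T]` (one-sided at `T`). -/
def dt {F : Type*} [NormedAddCommGroup F] [NormedSpace ℝ F] (T : ℝ) (f : ℝ → F) (t : ℝ) : F :=
  derivWithin f (Ioc 0 T) t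

/-! ### Outward normals -/

/-- `ν` is the unit outward normal to the open set `U` at `x`: near `x` the set `U` is the open half
space below the hyperplane through `x` orthogonal to `ν`. For a polyhedral set this holds
at every point in the relative interior of a face of the boundary. -/
def IsOuterNormalAt (U : Set (Pt d)) (x ν : Pt d) : Prop :=
  ‖ν‖ = 1 ∧ ∃ r > 0, ∀ y ∈ Metric.ball x r, y ∈ U ↔ inner ℝ (y - x) ν < 0

theorem IsOuterNormalAt.unique {U : Set (Pt d)} {x ν ν' : Pt d} (h : IsOuterNormalAt U x ν)
    (h' : IsOuterNormalAt U x ν') : ν = ν' := by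
  obtain ⟨h1, r, hr, h2⟩ := h
  obtain ⟨h1', r', hr', h2'⟩ := h'
  by_contra hne
  have hlt : inner ℝ ν ν' < 1 := (inner_lt_one_iff_real_of_norm_eq_one h1 h1').2 hne
  have hlt' : inner ℝ ν' ν < 1 := by rwa [real_inner_comm]
  set w : Pt d := ν' - ν with hw
  have hwpos : 0 < ‖w‖ := norm_pos_iff.2 (sub_ne_zero.2 (Ne.symm hne))
  set e : ℝ := min r r' / (2 * ‖w‖) with he
  have hepos : 0 < e := div_pos (lt_min hr hr') (by positivity)
  have hnorm : ‖e • w‖ = min r r' / 2 := by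
    rw [norm_smul, Real.norm_of_nonneg hepos.le, he]
    field_simp
  have hmin : 0 < min r r' := lt_min hr hr'
  have hb : x + e • w ∈ Metric.ball x r := by
    rw [Metric.mem_ball, dist_eq_norm, add_sub_cancel_left, hnorm]
    linarith [min_le_left r r']
  have hb' : x + e • w ∈ Metric.ball x r' := by
    rw [Metric.mem_ball, dist_eq_norm, add_sub_cancel_left, hnorm]
    linarith [min_le_right r r']
  have i1 : inner ℝ w ν < 0 := by
    rw [hw, inner_sub_left, real_inner_self_eq_norm_sq, h1]
    linarith
  have i2 : 0 < inner ℝ w ν' := by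
    rw [hw, inner_sub_left, real_inner_self_eq_norm_sq, h1']
    linarith
  have hU : x + e • w ∈ U := (h2 _ hb).2 (by
    rw [add_sub_cancel_left, real_inner_smul_left]
    exact mul_neg_of_pos_of_neg hepos i1)
  have hU' := (h2' _ hb').1 hU
  rw [add_sub_cancel_left, real_inner_smul_left] at hU'
  exact absurd hU' (not_lt.2 (mul_pos hepos i2).le)

/-- The unit outward normal to `U` at `x` (zero at the points, such as corners, without one). -/
def outerNormal (U : Set (Pt d)) (x : Pt d) : Pt d :=
  if h : ∃ ν, IsOuterNormalAt U x ν then h.choose else 0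

theorem IsOuterNormalAt.outerNormal_eq {U : Set (Pt d)} {x ν : Pt d} (h : IsOuterNormalAt U x ν) :
    outerNormal U x = ν := by
  have hex : ∃ ν, IsOuterNormalAt U x ν := ⟨ν, h⟩
  rw [outerNormal, dif_pos hex]
  exact hex.choose_spec.unique h

/-! ### The continuous problem -/

/-- The constant physical coefficients. -/
structure Coeff where
  /-- the viscosity `μˢ` and the Lamé constant `μᵇ` -/
  mu : Side → ℝ
  /-- the Lamé constant `λ` -/
  lam : ℝ
  /-- the Biot–Willis constant -/
  alpha : ℝ
  /-- the specific storage coefficient -/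
  c0 : ℝ
  /-- the permeability -/
  kappa : ℝ
  /-- the slip coefficient of the Beavers–Joseph–Saffman condition -/
  gam : ℝ
  mu_pos : ∀ j, 0 < mu j
  lam_ne : lam ≠ 0
  alpha_pos : 0 < alpha
  alpha_lt : alpha < 1
  c0_nonneg : 0 ≤ c0
  kappa_pos : 0 < kappa
  gam_pos : 0 < gam

/-- The domain `Ω`, its partition into `Ωˢ` and `Ωᵇ`, and the partitions of the boundary pieces.
That the domains are polyhedral is expressed by `IsMesh` below; `interior (closure U) = U`
says that they are open and lie locally on one side of their boundary. -/
structure Domains (d : ℕ) where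
  Om : Set (Pt d)
  sub : Side → Set (Pt d)
  GD : Side → Set (Pt d)
  GN : Side → Set (Pt d)
  GP : Set (Pt d)
  GF : Set (Pt d)
  regular : interior (closure Om) = Om
  sub_regular : ∀ j, interior (closure (sub j)) = sub j
  sub_subset : ∀ j, sub j ⊆ Om
  sub_disjoint : Disjoint (sub .s) (sub .b)
  cover : Om ⊆ closure (sub .s) ∪ closure (sub .b)
  DN_union : ∀ j, GD j ∪ GN j = frontier Om ∩ frontier (sub j)
  DN_disjoint : ∀ j, Disjoint (GD j) (GN j)
  PF_union : GP ∪ GF = frontier Om ∩ frontier (sub .b)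
  PF_disjoint : Disjoint GP GF

/-- The outer boundary piece `Γʲ = ∂Ω ∩ ∂Ωʲ`. -/
def Domains.G (D : Domains d) (j : Side) : Set (Pt d) := frontier D.Om ∩ frontier (D.sub j)

/-- The interface `Γ_I`. -/
def Domains.GI (D : Domains d) : Set (Pt d) := frontier (D.sub .s) ∩ frontier (D.sub .b)

/-- `(u, p, z, pᵖ)` is a solution, smooth up to the boundary, of the coupled Stokes–Biot equations
with the interface and boundary conditions on the time interval `J = (0, T]`. -/
structure IsSmoothSolution (P : Coeff) (D : Domains d) (T : ℝ)
    (f : Side → ℝ → Pt d → Pt d) (g : ℝ → Pt d → ℝ)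
    (u : Side → ℝ → Pt d → Pt d) (p : Side → ℝ → Pt d → ℝ)
    (z : ℝ → Pt d → Pt d) (pp : ℝ → Pt d → ℝ) : Prop where
  -- regularity in space
  u_smooth : ∀ j, ∀ t ∈ Ioc 0 T, ContDiffOn ℝ 2 (u j t) (closure (D.sub j))
  p_smooth : ∀ j, ∀ t ∈ Ioc 0 T, ContDiffOn ℝ 1 (p j t) (closure (D.sub j))
  z_smooth : ∀ t ∈ Ioc 0 T, ContDiffOn ℝ 1 (z t) (closure (D.sub .b))
  pp_smooth : ∀ t ∈ Ioc 0 T, ContDiffOn ℝ 1 (pp t) (closure (D.sub .b))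
  -- existence and continuity of the time derivatives that occur in the problem
  ub_time : ∀ t ∈ Ioc 0 T, ∀ x ∈ closure (D.sub .b),
    DifferentiableWithinAt ℝ (fun s => u .b s x) (Ioc 0 T) t
  pb_time : ∀ t ∈ Ioc 0 T, ∀ x ∈ closure (D.sub .b),
    DifferentiableWithinAt ℝ (fun s => p .b s x) (Ioc 0 T) t
  pp_time : ∀ t ∈ Ioc 0 T, ∀ x ∈ closure (D.sub .b),
    DifferentiableWithinAt ℝ (fun s => pp s x) (Ioc 0 T) t
  dt_ub_cont : ∀ t ∈ Ioc 0 T,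
    ContinuousOn (fun x => dt T (fun s => u .b s x) t) (closure (D.sub .b))
  dt_pb_cont : ∀ t ∈ Ioc 0 T,
    ContinuousOn (fun x => dt T (fun s => p .b s x) t) (closure (D.sub .b))
  dt_pp_cont : ∀ t ∈ Ioc 0 T,
    ContinuousOn (fun x => dt T (fun s => pp s x) t) (closure (D.sub .b))
  -- the equations in the subdomains
  momentum : ∀ j, ∀ t ∈ Ioc 0 T, ∀ x ∈ D.sub j,
    -matDiv (closure (D.sub j)) (stress (closure (D.sub j)) (P.mu j) (u j t) (p j t)) x = f j t x
  incompressible : ∀ t ∈ Ioc 0 T, ∀ x ∈ D.sub .s, -divg (closure (D.sub .s)) (u .s t) x = 0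
  total_pressure : ∀ t ∈ Ioc 0 T, ∀ x ∈ D.sub .b,
    -divg (closure (D.sub .b)) (u .b t) x + P.lam⁻¹ * (P.alpha * pp t x - p .b t x) = 0
  mass : ∀ t ∈ Ioc 0 T, ∀ x ∈ D.sub .b,
    P.c0 * dt T (fun s => pp s x) t
      + P.alpha * P.lam⁻¹ * (P.alpha * dt T (fun s => pp s x) t - dt T (fun s => p .b s x) t)
      + divg (closure (D.sub .b)) (z t) x = g t x
  darcy : ∀ t ∈ Ioc 0 T, ∀ x ∈ D.sub .b,
    P.kappa⁻¹ • z t x + grad (closure (D.sub .b)) (pp t) x = 0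
  -- the interface conditions; `n` is the normal that points out of `Ωˢ`
  interface_flux : ∀ t ∈ Ioc 0 T, ∀ x ∈ D.GI, ∀ n, IsOuterNormalAt (D.sub .s) x n →
    inner ℝ (u .s t x) n = inner ℝ (dt T (fun s => u .b s x) t + z t x) n
  interface_stress : ∀ t ∈ Ioc 0 T, ∀ x ∈ D.GI, ∀ n, IsOuterNormalAt (D.sub .s) x n →
    mv (stress (closure (D.sub .s)) (P.mu .s) (u .s t) (p .s t) x) n
      = mv (stress (closure (D.sub .b)) (P.mu .b) (u .b t) (p .b t) x) n
  interface_pressure : ∀ t ∈ Ioc 0 T, ∀ x ∈ D.GI, ∀ n, IsOuterNormalAt (D.sub .s) x n →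
    -inner ℝ (mv (stress (closure (D.sub .s)) (P.mu .s) (u .s t) (p .s t) x) n) n = pp t x
  interface_slip : ∀ t ∈ Ioc 0 T, ∀ x ∈ D.GI, ∀ n, IsOuterNormalAt (D.sub .s) x n →
    -(2 * P.mu .s) • tang n (mv (eps (closure (D.sub .s)) (u .s t) x) n)
      = (P.gam * Real.sqrt (P.mu .s / P.kappa)) •
          tang n (u .s t x - dt T (fun s => u .b s x) t)
  -- the boundary conditions
  bc_D : ∀ j, ∀ t ∈ Ioc 0 T, ∀ x ∈ D.GD j, u j t x = 0
  bc_N : ∀ j, ∀ t ∈ Ioc 0 T, ∀ x ∈ D.GN j, ∀ n, IsOuterNormalAt D.Om x n →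
    mv (stress (closure (D.sub j)) (P.mu j) (u j t) (p j t) x) n = 0
  bc_P : ∀ t ∈ Ioc 0 T, ∀ x ∈ D.GP, pp t x = 0
  bc_F : ∀ t ∈ Ioc 0 T, ∀ x ∈ D.GF, ∀ n, IsOuterNormalAt D.Om x n → inner ℝ (z t x) n = 0

/-! ### Triangulations -/

/-- The closed simplex with the given set of vertices. -/
def hull (K : Finset (Pt d)) : Set (Pt d) := convexHull ℝ (K : Set (Pt d))

/-- A finite conforming triangulation of `U` into nondegenerate `d`-simplices, each of them given
by its set of vertices: two simplices meet in the common face spanned by their common vertices. -/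
structure IsTriangulation (U : Set (Pt d)) (T : Finset (Finset (Pt d))) : Prop where
  card : ∀ K ∈ T, K.card = d + 1
  indep : ∀ K ∈ T, AffineIndependent ℝ ((↑) : K → Pt d)
  conforming : ∀ K ∈ T, ∀ L ∈ T, hull K ∩ hull L = hull (K ∩ L)
  cover : ⋃ K ∈ T, hull K = closure U

/-- The facets of a simplex, given by their vertices. -/
def facetsOf (K : Finset (Pt d)) : Finset (Finset (Pt d)) := K.powersetCard d

/-- The facets of the elements of a triangulation. -/
def facets (T : Finset (Finset (Pt d))) : Finset (Finset (Pt d)) := T.biUnion facetsOf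

/-- The facet `F` lies on `S`, up to a set of zero `(d-1)`-dimensional measure. -/
def LiesOn (F : Finset (Pt d)) (S : Set (Pt d)) : Prop := μHE[d - 1] (hull F \ S) = 0

/-- `Tr j` triangulates `Ωʲ`, the two triangulations match at the interface, and they resolve the
partitions of the boundary: a facet on the boundary belongs to one of the pieces. -/
structure IsMesh (D : Domains d) (Tr : Side → Finset (Finset (Pt d))) : Prop where
  sub : ∀ j, IsTriangulation (D.sub j) (Tr j)
  whole : IsTriangulation D.Om (Tr .s ∪ Tr .b)
  resolve_DN : ∀ j, ∀ F ∈ facets (Tr j), LiesOn F (D.G j) → LiesOn F (D.GD j) ∨ LiesOn F (D.GN j)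
  resolve_PF : ∀ F ∈ facets (Tr .b), LiesOn F (D.G .b) → LiesOn F D.GP ∨ LiesOn F D.GF

/-- The facets on the interface. -/
def facetsI (D : Domains d) (Tr : Side → Finset (Finset (Pt d))) : Finset (Finset (Pt d)) :=
  (facets (Tr .s) ∪ facets (Tr .b)).filter fun F => LiesOn F D.GI

/-! ### Discrete functions -/

/-- Element functions and facet functions: one function for each element or each facet, so
that an element function has its own trace from each side of a facet. Only the
values `v K x` for `x ∈ K` are ever used. -/
abbrev MeshFn (d : ℕ) (α : Type*) := Finset (Pt d) → Pt d → α

/-- `f` is a polynomial of degree at most `k` on `S`. -/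
def IsPolyOn (k : ℕ) (S : Set (Pt d)) (f : Pt d → ℝ) : Prop :=
  ∃ q : MvPolynomial (Fin d) ℝ, q.totalDegree ≤ k ∧
    ∀ x ∈ S, f x = MvPolynomial.eval (fun i => x i) q

/-- All components of `w` are polynomials of degree at most `k` on `S`. -/
def IsVecPolyOn (k : ℕ) (S : Set (Pt d)) (w : Pt d → Pt d) : Prop :=
  ∀ i, IsPolyOn k S fun x => w x i

/-- The space of vector element functions that are in `[P_k(K)]ᵈ` for `K ∈ T`. -/
def MemV (T : Finset (Finset (Pt d))) (k : ℕ) (v : MeshFn d (Pt d)) : Prop :=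
  ∀ K ∈ T, IsVecPolyOn k (hull K) (v K)

/-- The space of scalar element functions that are in `P_{k-1}(K)` for `K ∈ T`. -/
def MemQ (T : Finset (Finset (Pt d))) (k : ℕ) (q : MeshFn d ℝ) : Prop :=
  ∀ K ∈ T, IsPolyOn (k - 1) (hull K) (q K)

/-- The space of vector facet functions in `[P_k(F)]ᵈ` that vanish on `GD`. -/
def MemVbar (T : Finset (Finset (Pt d))) (GD : Set (Pt d)) (k : ℕ) (v : MeshFn d (Pt d)) : Prop :=
  ∀ F ∈ facets T, IsVecPolyOn k (hull F) (v F) ∧ (LiesOn F GD → ∀ x ∈ hull F, v F x = 0)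

/-- The space of scalar facet functions in `P_k(F)`. -/
def MemQbar (T : Finset (Finset (Pt d))) (k : ℕ) (q : MeshFn d ℝ) : Prop :=
  ∀ F ∈ facets T, IsPolyOn k (hull F) (q F)

/-- The space of scalar facet functions in `P_k(F)` that vanish on `GP`. -/
def MemQbar0 (T : Finset (Finset (Pt d))) (GP : Set (Pt d)) (k : ℕ) (q : MeshFn d ℝ) : Prop :=
  MemQbar T k q ∧ ∀ F ∈ facets T, LiesOn F GP → ∀ x ∈ hull F, q F x = 0

/-! ### Integrals and forms -/

/-- `∫_K f dx`. -/
def cellInt (K : Finset (Pt d)) (f : Pt d → ℝ) : ℝ := ∫ x in hull K, f x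

/-- `∫_F f ds`, with the surface measure. -/
def facetInt (F : Finset (Pt d)) (f : Pt d → ℝ) : ℝ := ∫ x in hull F, f x ∂μHE[d - 1]

/-- `∫_{∂K} f ds`, where the integrand may depend on the facet. -/
def bdryInt (K : Finset (Pt d)) (f : MeshFn d ℝ) : ℝ := ∑ F ∈ facetsOf K, facetInt F (f F)

/-- The unit outward normal to the element `K`. -/
def cellNormal (K : Finset (Pt d)) (x : Pt d) : Pt d := outerNormal (interior (hull K)) x

/-- `a_hʲ((u, ū), (v, v̄))`. -/
def ahj (T : Finset (Finset (Pt d))) (μ β : ℝ) (u ub v vb : MeshFn d (Pt d)) : ℝ :=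
  (∑ K ∈ T, cellInt K fun x => 2 * μ * frob (eps (hull K) (u K) x) (eps (hull K) (v K) x))
    + (∑ K ∈ T, bdryInt K fun F x =>
        2 * β * μ * (Metric.diam (hull K))⁻¹ * inner ℝ (u K x - ub F x) (v K x - vb F x))
    - (∑ K ∈ T, bdryInt K fun F x =>
        inner ℝ ((2 * μ) • mv (eps (hull K) (u K) x) (cellNormal K x)) (v K x - vb F x))
    - (∑ K ∈ T, bdryInt K fun F x =>
        inner ℝ ((2 * μ) • mv (eps (hull K) (v K) x) (cellNormal K x)) (u K x - ub F x))

/-- `b_hʲ((q, q̄), (v, v̄))`. -/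
def bhj (T : Finset (Finset (Pt d))) (q qb : MeshFn d ℝ) (v vb : MeshFn d (Pt d)) : ℝ :=
  -(∑ K ∈ T, cellInt K fun x => q K x * divg (hull K) (v K) x)
    + ∑ K ∈ T, bdryInt K fun F x => qb F x * inner ℝ (v K x - vb F x) (cellNormal K x)

/-- `a_h = a_hˢ + a_hᵇ`. -/
def ah (P : Coeff) (Tr : Side → Finset (Finset (Pt d))) (β : Side → ℝ)
    (u : MeshFn d (Pt d)) (ub : Side → MeshFn d (Pt d))
    (v : MeshFn d (Pt d)) (vb : Side → MeshFn d (Pt d)) : ℝ :=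
  ahj (Tr .s) (P.mu .s) (β .s) u (ub .s) v (vb .s)
    + ahj (Tr .b) (P.mu .b) (β .b) u (ub .b) v (vb .b)

/-- `b_h = b_hˢ + b_hᵇ`. -/
def bh (Tr : Side → Finset (Finset (Pt d)))
    (q : MeshFn d ℝ) (qb : Side → MeshFn d ℝ)
    (v : MeshFn d (Pt d)) (vb : Side → MeshFn d (Pt d)) : ℝ :=
  bhj (Tr .s) q (qb .s) v (vb .s) + bhj (Tr .b) q (qb .b) v (vb .b)

/-- `c_h((p, r), q) = (λ⁻¹ (α p - r), q)_{Ωᵇ}`. -/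
def ch (P : Coeff) (Tr : Side → Finset (Finset (Pt d))) (p r q : MeshFn d ℝ) : ℝ :=
  ∑ K ∈ Tr .b, cellInt K fun x => P.lam⁻¹ * (P.alpha * p K x - r K x) * q K x

/-- `a_hᴵ((ūˢ, ūᵇ), (v̄ˢ, v̄ᵇ))`, with `n = nˢ` on the interface. -/
def ahI (P : Coeff) (D : Domains d) (Tr : Side → Finset (Finset (Pt d)))
    (us ub vs vb : MeshFn d (Pt d)) : ℝ :=
  ∑ F ∈ facetsI D Tr, facetInt F fun x =>
    P.gam * Real.sqrt (P.mu .s / P.kappa) *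
      inner ℝ (tang (outerNormal (D.sub .s) x) (us F x - ub F x))
        (tang (outerNormal (D.sub .s) x) (vs F x - vb F x))

/-- `b_hᴵ(q̄, (v̄ˢ, v̄ᵇ))`, with `n = nˢ` on the interface. -/
def bhI (D : Domains d) (Tr : Side → Finset (Finset (Pt d)))
    (q : MeshFn d ℝ) (vs vb : MeshFn d (Pt d)) : ℝ :=
  ∑ F ∈ facetsI D Tr, facetInt F fun x =>
    q F x * inner ℝ (vs F x - vb F x) (outerNormal (D.sub .s) x)

/-- The time derivative of an element or facet function. -/
def dtFn {F : Type*} [NormedAddCommGroup F] [NormedSpace ℝ F] (T : ℝ)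
    (v : ℝ → MeshFn d F) (t : ℝ) : MeshFn d F :=
  fun K x => dt T (fun s => v s K x) t

/-- The semi-discrete HDG equations on `J = (0, T]` for the element and facet functions
`(u, ūˢ, ūᵇ)`, `(p, p̄ˢ, p̄ᵇ)`, `z`, `(pᵖ, p̄ᵖ)`. -/
def SatisfiesSemidiscreteHDG (P : Coeff) (D : Domains d) (Tr : Side → Finset (Finset (Pt d)))
    (k : ℕ) (β : Side → ℝ) (T : ℝ) (f : Side → ℝ → Pt d → Pt d) (g : ℝ → Pt d → ℝ)
    (u : ℝ → MeshFn d (Pt d)) (ubar : Side → ℝ → MeshFn d (Pt d))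
    (p : ℝ → MeshFn d ℝ) (pbar : Side → ℝ → MeshFn d ℝ)
    (z : ℝ → MeshFn d (Pt d)) (pp ppbar : ℝ → MeshFn d ℝ) : Prop :=
  ∀ t ∈ Ioc 0 T,
  ∀ (v : MeshFn d (Pt d)) (vbar : Side → MeshFn d (Pt d))
    (q : MeshFn d ℝ) (qbar : Side → MeshFn d ℝ)
    (w : MeshFn d (Pt d)) (qp qpbar : MeshFn d ℝ),
  MemV (Tr .s ∪ Tr .b) k v → (∀ j, MemVbar (Tr j) (D.GD j) k (vbar j)) →
  MemQ (Tr .s ∪ Tr .b) k q → (∀ j, MemQbar (Tr j) k (qbar j)) →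
  MemV (Tr .b) k w → MemQ (Tr .b) k qp → MemQbar0 (Tr .b) D.GP k qpbar →
  (ah P Tr β (u t) (fun j => ubar j t) v vbar
      + ahI P D Tr (ubar .s t) (dtFn T (ubar .b) t) (vbar .s) (vbar .b)
      + bh Tr (p t) (fun j => pbar j t) v vbar
      + bhI D Tr (ppbar t) (vbar .s) (vbar .b)
    = (∑ K ∈ Tr .s, cellInt K fun x => inner ℝ (f .s t x) (v K x))
      + ∑ K ∈ Tr .b, cellInt K fun x => inner ℝ (f .b t x) (v K x))
  ∧ (bh Tr q qbar (u t) (fun j => ubar j t) + ch P Tr (pp t) (p t) q = 0)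
  ∧ ((∑ K ∈ Tr .b, cellInt K fun x => P.c0 * dtFn T pp t K x * qp K x)
      + ch P Tr (dtFn T pp t) (dtFn T p t) (fun K x => P.alpha * qp K x)
      - bhj (Tr .b) qp qpbar (z t) (fun _ _ => 0)
      - bhI D Tr qpbar (ubar .s t) (dtFn T (ubar .b) t)
    = ∑ K ∈ Tr .b, cellInt K fun x => g t x * qp K x)
  ∧ ((∑ K ∈ Tr .b, cellInt K fun x => inner ℝ (P.kappa⁻¹ • z t K x) (w K x))
      + bhj (Tr .b) (pp t) (ppbar t) w (fun _ _ => 0) = 0)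

/-- The function on `Ω` that equals `wʲ` on the elements of `Ωʲ`. -/
def glue {α : Type*} (Tr : Side → Finset (Finset (Pt d))) (w : Side → Pt d → α) : MeshFn d α :=
  fun K => if K ∈ Tr .s then w .s else w .b

/-- The element or facet function given by the restrictions of one function. -/
def restrict {α : Type*} (w : Pt d → α) : MeshFn d α := fun _ => w

end StokesBiot

end

/-! Consistency holds because the facet unknowns of the exact solution are the traces of its element
unknowns. Every jump `u - ū` vanishes, so the penalty term and the symmetrising term drop out. Each
discrete equation then reduces to the continuous one, multiplied by a test function and integrated
over the elements.

In the momentum equation, integration by parts on an element `K` produces `⟨σ n, v⟩` on `∂K`. The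
consistency term and the pressure facet term together contribute `-⟨σ n, v - v̄⟩`, so only `⟨σ n,
v̄⟩` survives (`momentum_side`). Both `σ` and `v̄` are single-valued on the facets of one subdomain.
Hence interior facets cancel, outer facets contribute nothing because `v̄ = 0` or `σ n = 0` there,
and what remains is `σˢ n · v̄ˢ - σᵇ n · v̄ᵇ` on the interface (`IsMesh.sum_bdryInt`). The stress,
pressure and slip conditions say pointwise that this is minus the integrand of the interface forms
(`interface_balance`). The mass balance uses the same summation for the flux `q̄ z` and the
interface flux condition. The total pressure equation and Darcy's law already hold element by
element.

Two tools carry this. The first is the divergence theorem on a simplex for functions that are C¹ up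
to the boundary, with Hausdorff measure on the facets. Fubini along an edge direction and the
fundamental theorem of calculus give a difference of two integrals over one facet; sliding along the
edge (`integral_face_slide`) turns one of them into an integral over another facet, and edges span
all directions. The second is mesh combinatorics: a conforming mesh has at most two elements at a
facet, with opposite normals there, and a facet with only one element lies on the boundary of the
triangulated set. -/

noncomputable section

set_option linter.unusedSectionVars false

namespace StokesBiot

/-! ### Fubini along parallel hyperplanes, with Hausdorff measure on the slice. -/

section Slicing

variable {E : Type*} [NormedAddCommGroup E] [InnerProductSpace ℝ E] [FiniteDimensional ℝ E]
  [MeasurableSpace E] [BorelSpace E]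

/-- Orthonormal slicing coordinates preserve the volume. -/
theorem measurePreserving_orthogonal_slices (p : E) {n : E} (hn : ‖n‖ = 1) :
    MeasurePreserving (fun q : ℝ × (ℝ ∙ n)ᗮ => p + (q.2 : E) + q.1 • n)
      (volume.prod volume) volume := by
  have h1 : MeasurePreserving (LinearIsometryEquiv.toSpanUnitSingleton n hn)
      volume volume := LinearIsometryEquiv.measurePreserving _
  have h2 := (h1.prod (MeasurePreserving.id (volume : Measure (ℝ ∙ n)ᗮ)))
  have h3 := ((ℝ ∙ n).measurePreserving_measurableEquivProd p).symm
  rw [InnerProductSpace.euclideanHausdorffMeasure_eq_volume] at h3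
  have h4 := h3.comp h2
  refine (congrArg (fun F => MeasurePreserving F (volume.prod volume) volume) (funext fun q => ?_)).mp h4
  simp [add_comm]
  abel

/-- Slicing along a direction `e` that is transversal to the hyperplane. -/
theorem measurePreserving_oblique_slices (p : E) {n e : E} (hn : ‖n‖ = 1)
    (hc : inner ℝ n e ≠ (0 : ℝ)) :
    MeasurePreserving (fun q : ℝ × (ℝ ∙ n)ᗮ => p + (q.2 : E) + q.1 • e)
      ((ENNReal.ofReal |inner ℝ n e| • volume).prod volume) volume := by
  set c : ℝ := inner ℝ n e with hcdef
  have he : e - c • n ∈ (ℝ ∙ n)ᗮ := by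
    rw [Submodule.mem_orthogonal_singleton_iff_inner_right, inner_sub_right, inner_smul_right,
      real_inner_self_eq_norm_sq, hn]
    simp [hcdef]
  -- With `e = c n + e'`, the oblique chart is the orthogonal one after `(s, y) ↦ (c s, y + s e')`.
  -- The shear preserves volume, so the only Jacobian is `|c|`.
  set e' : (ℝ ∙ n)ᗮ := ⟨e - c • n, he⟩ with he'
  have h1 : MeasurePreserving (fun s : ℝ => c * s) (ENNReal.ofReal |c| • volume) volume :=
    ⟨by fun_prop, by rw [Measure.map_smul, Real.smul_map_volume_mul_left hc]⟩
  have h2 : MeasurePreserving (fun q : ℝ × (ℝ ∙ n)ᗮ => (c * q.1, q.2 + q.1 • e'))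
      ((ENNReal.ofReal |c| • volume).prod volume) (volume.prod volume) := by
    refine h1.skew_product (g := fun s y => y + s • e') (by fun_prop) ?_
    refine Filter.Eventually.of_forall fun s => ?_
    exact (measurePreserving_add_right volume (s • e')).map_eq
  convert (measurePreserving_orthogonal_slices p hn).comp h2 using 2 with q
  simp [he', smul_sub, smul_smul, mul_comm]
  abel

/-- The hyperplane through `p` orthogonal to `n`. -/
def hyperplane (p n : E) : Set E := {x | inner ℝ n (x - p) = (0 : ℝ)}

theorem isometry_hyperplane (p n : E) : Isometry fun y : (ℝ ∙ n)ᗮ => p + (y : E) :=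
  Isometry.of_dist_eq fun x y => by simp [Subtype.dist_eq]

theorem range_hyperplane (p n : E) : range (fun y : (ℝ ∙ n)ᗮ => p + (y : E)) = hyperplane p n := by
  ext x
  constructor
  · rintro ⟨y, rfl⟩
    have := (Submodule.mem_orthogonal_singleton_iff_inner_right).1 y.2
    simpa [hyperplane] using this
  · intro hx
    exact ⟨⟨x - p, Submodule.mem_orthogonal_singleton_iff_inner_right.2 hx⟩, by simp⟩

theorem finrank_hyperplane {n : E} (hn : ‖n‖ = 1) :
    Module.finrank ℝ (ℝ ∙ n)ᗮ = Module.finrank ℝ E - 1 := by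
  have h0 : n ≠ 0 := by rintro rfl; simp at hn
  have := (ℝ ∙ n).finrank_add_finrank_orthogonal
  rw [finrank_span_singleton h0] at this
  omega

/-- Isometries transport Hausdorff measure, and on a Euclidean space the normalised Hausdorff
measure of its own dimension is the volume. Surface integrals thus become Lebesgue integrals in a
chart. -/
theorem map_volume_hyperplane (p : E) {n : E} (hn : ‖n‖ = 1) :
    (volume : Measure (ℝ ∙ n)ᗮ).map (fun y : (ℝ ∙ n)ᗮ => p + (y : E))
      = (μHE[Module.finrank ℝ E - 1]).restrict (hyperplane p n) := by
  rw [← InnerProductSpace.euclideanHausdorffMeasure_eq_volume, finrank_hyperplane hn,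
    (isometry_hyperplane p n).map_euclideanHausdorffMeasure, range_hyperplane]

theorem setIntegral_hyperplane (p : E) {n : E} (hn : ‖n‖ = 1) (f : E → ℝ) :
    ∫ x in hyperplane p n, f x ∂μHE[Module.finrank ℝ E - 1] = ∫ y : (ℝ ∙ n)ᗮ, f (p + y) := by
  rw [← map_volume_hyperplane p hn,
    (isometry_hyperplane p n).isClosedEmbedding.measurableEmbedding.integral_map]

theorem integral_eq_integral_slices (p : E) {n e : E} (hn : ‖n‖ = 1)
    (hc : inner ℝ n e ≠ (0 : ℝ)) {g : E → ℝ} (hg : Integrable g) :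
    ∫ x, g x = |inner ℝ n e| *
      ∫ x in hyperplane p n, (∫ s : ℝ, g (x + s • e)) ∂μHE[Module.finrank ℝ E - 1] := by
  have h := measurePreserving_oblique_slices p hn hc
  have hint : Integrable (fun q : ℝ × (ℝ ∙ n)ᗮ => g (p + (q.2 : E) + q.1 • e))
      ((ENNReal.ofReal |inner ℝ n e| • volume).prod volume) := h.integrable_comp_of_integrable hg
  have h1 : ∫ x, g x = ∫ q : ℝ × (ℝ ∙ n)ᗮ, g (p + (q.2 : E) + q.1 • e)
      ∂((ENNReal.ofReal |inner ℝ n e| • volume).prod volume) := by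
    rw [← h.map_eq, integral_map h.aemeasurable]
    rw [h.map_eq]; exact hg.1
  rw [h1, setIntegral_hyperplane p hn, integral_prod_symm _ hint]
  simp_rw [integral_smul_measure]
  rw [integral_smul]
  simp

end Slicing

/-! ### Simplices and facets in barycentric coordinates. -/

section Simplex

variable {E : Type*} [NormedAddCommGroup E] [InnerProductSpace ℝ E] [FiniteDimensional ℝ E]
variable {ι : Type*} [Fintype ι]

/-- The gradient of a barycentric coordinate. -/
def coordGrad (b : AffineBasis ι ℝ E) (i : ι) : E :=
  (InnerProductSpace.toDual ℝ E).symm (LinearMap.toContinuousLinearMap (b.coord i).linear)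

theorem inner_coordGrad (b : AffineBasis ι ℝ E) (i : ι) (v : E) :
    inner ℝ (coordGrad b i) v = (b.coord i).linear v := by
  simp [coordGrad]

theorem coord_add_smul (b : AffineBasis ι ℝ E) (i : ι) (x e : E) (s : ℝ) :
    b.coord i (x + s • e) = b.coord i x + s * (b.coord i).linear e := by
  have := (b.coord i).map_vadd x (s • e)
  rw [vadd_eq_add, add_comm] at this
  rw [this, map_smul, vadd_eq_add, smul_eq_mul, add_comm]

theorem coord_linear_sub (b : AffineBasis ι ℝ E) (k : ι) (x y : E) :
    (b.coord k).linear (x - y) = b.coord k x - b.coord k y :=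
  (b.coord k).linearMap_vsub x y

theorem coord_linear_edge (b : AffineBasis ι ℝ E) (i j k : ι) :
    (b.coord k).linear (b j - b i) = (if k = j then 1 else 0) - (if k = i then 1 else 0) := by
  rw [coord_linear_sub, b.coord_apply, b.coord_apply]

theorem sum_coord_linear (b : AffineBasis ι ℝ E) (v : E) :
    ∑ k, (b.coord k).linear v = 0 := by
  have h1 := b.sum_coord_apply_eq_one v
  have h0 := b.sum_coord_apply_eq_one (0 : E)
  have := fun k => coord_linear_sub b k v 0
  simp only [sub_zero] at this
  simp only [this, Finset.sum_sub_distrib, h1, h0, sub_self]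

theorem sum_coord_linear_smul (b : AffineBasis ι ℝ E) (v : E) :
    ∑ k, (b.coord k).linear v • b k = v := by
  have h1 := b.linear_combination_coord_eq_self v
  have h0 := b.linear_combination_coord_eq_self (0 : E)
  have := fun k => coord_linear_sub b k v 0
  simp only [sub_zero] at this
  simp only [this, sub_smul, Finset.sum_sub_distrib, h1, h0, sub_zero]

/-- The closed simplex spanned by an affine basis. -/
def solid (b : AffineBasis ι ℝ E) : Set E := {x | ∀ k, 0 ≤ b.coord k x}

/-- The facet opposite to the vertex `b i`. -/
def face (b : AffineBasis ι ℝ E) (i : ι) : Set E := {x | b.coord i x = 0 ∧ ∀ k, 0 ≤ b.coord k x}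

theorem solid_eq_convexHull (b : AffineBasis ι ℝ E) : solid b = convexHull ℝ (range b) :=
  b.convexHull_eq_nonneg_coord.symm

theorem isCompact_solid (b : AffineBasis ι ℝ E) : IsCompact (solid b) := by
  rw [solid_eq_convexHull]
  exact (finite_range b).isCompact_convexHull (𝕜 := ℝ)

theorem isCompact_face (b : AffineBasis ι ℝ E) (i : ι) : IsCompact (face b i) := by
  have : face b i = solid b ∩ b.coord i ⁻¹' {0} := by
    ext x; simp [face, solid, and_comm]
  rw [this]
  exact (isCompact_solid b).inter_right
    (isClosed_singleton.preimage (b.coord i).continuous_of_finiteDimensional)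

theorem face_subset_solid (b : AffineBasis ι ℝ E) (i : ι) : face b i ⊆ solid b := fun _ h => h.2

theorem interior_solid (b : AffineBasis ι ℝ E) : interior (solid b) = {x | ∀ k, 0 < b.coord k x} := by
  rw [solid_eq_convexHull]
  exact b.interior_convexHull

theorem interior_solid_nonempty (b : AffineBasis ι ℝ E) : (interior (solid b)).Nonempty := by
  rw [solid_eq_convexHull]
  exact ⟨_, b.centroid_mem_interior_convexHull⟩

theorem convex_solid (b : AffineBasis ι ℝ E) : Convex ℝ (solid b) := by
  rw [solid_eq_convexHull]
  exact convex_convexHull ℝ _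

theorem uniqueDiffOn_solid (b : AffineBasis ι ℝ E) : UniqueDiffOn ℝ (solid b) :=
  uniqueDiffOn_convex (convex_solid b) (interior_solid_nonempty b)

theorem coordGrad_ne_zero (b : AffineBasis ι ℝ E) {i j : ι} (hij : i ≠ j) : coordGrad b i ≠ 0 := by
  intro h
  have := inner_coordGrad b i (b i - b j)
  rw [h, inner_zero_left, coord_linear_edge] at this
  simp [hij] at this

/-- A second vertex `b j` is needed: it is a base point on the zero set, and it makes the coordinate
nonconstant, so that its gradient can be normalised. -/
theorem hyperplane_coordGrad (b : AffineBasis ι ℝ E) {i j : ι} (hij : i ≠ j) :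
    hyperplane (b j) (‖coordGrad b i‖⁻¹ • coordGrad b i) = {x | b.coord i x = 0} := by
  ext x
  have h0 : ‖coordGrad b i‖ ≠ 0 := norm_ne_zero_iff.2 (coordGrad_ne_zero b hij)
  simp only [hyperplane, mem_ofPred_eq, real_inner_smul_left, inner_coordGrad, coord_linear_sub,
    b.coord_apply_ne hij, sub_zero, mul_eq_zero, inv_eq_zero, h0, false_or]

variable [MeasurableSpace E] [BorelSpace E]

/-- Normalising `e` so that the `i`-th coordinate changes at unit rate makes the Jacobian
`‖coordGrad b i‖⁻¹`, the height of the simplex over the facet. It no longer depends on `e`, so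
slicings by two facets along one edge can be compared. -/
theorem integral_eq_integral_coord_slices (b : AffineBasis ι ℝ E) {i j : ι} (hij : i ≠ j) {e : E}
    (he : |(b.coord i).linear e| = 1) {g : E → ℝ} (hg : Integrable g) :
    ∫ x, g x = ‖coordGrad b i‖⁻¹ *
      ∫ x in {x | b.coord i x = 0}, (∫ s : ℝ, g (x + s • e)) ∂μHE[Module.finrank ℝ E - 1] := by
  have h0 : ‖coordGrad b i‖ ≠ 0 := norm_ne_zero_iff.2 (coordGrad_ne_zero b hij)
  have hin : |inner ℝ (‖coordGrad b i‖⁻¹ • coordGrad b i) e| = ‖coordGrad b i‖⁻¹ := by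
    rw [real_inner_smul_left, inner_coordGrad, abs_mul, he, mul_one, abs_of_nonneg (by positivity)]
  have h := integral_eq_integral_slices (b j) (n := ‖coordGrad b i‖⁻¹ • coordGrad b i) (e := e)
    (by rw [norm_smul, norm_inv, norm_norm, inv_mul_cancel₀ h0])
    (by rw [← abs_pos, hin]; positivity) hg
  rw [h, hin, hyperplane_coordGrad b hij]

/-- Compactness in the ambient space does not bound a lower-dimensional Hausdorff measure; the bound
comes from the isometric chart of the hyperplane, where the facet is a compact set of finite volume.
-/
theorem measure_face_lt_top (b : AffineBasis ι ℝ E) {i j : ι} (hij : i ≠ j) :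
    μHE[Module.finrank ℝ E - 1] (face b i) < ⊤ := by
  have h0 : ‖coordGrad b i‖ ≠ 0 := norm_ne_zero_iff.2 (coordGrad_ne_zero b hij)
  have hn : ‖‖coordGrad b i‖⁻¹ • coordGrad b i‖ = 1 := by
    rw [norm_smul, norm_inv, norm_norm, inv_mul_cancel₀ h0]
  have h := map_volume_hyperplane (b j) hn
  rw [hyperplane_coordGrad b hij] at h
  have hsub : face b i ∩ {x | b.coord i x = 0} = face b i := inter_eq_left.2 fun x hx => hx.1
  rw [← hsub, ← Measure.restrict_apply (isCompact_face b i).measurableSet, ← h]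
  have hemb := (isometry_hyperplane (b j) (‖coordGrad b i‖⁻¹ • coordGrad b i)).isClosedEmbedding
  rw [hemb.measurableEmbedding.map_apply]
  exact (hemb.isCompact_preimage (isCompact_face b i)).measure_lt_top

theorem integrableOn_face (b : AffineBasis ι ℝ E) {i j : ι} (hij : i ≠ j) {f : E → ℝ}
    (hf : ContinuousOn f (face b i)) :
    IntegrableOn f (face b i) μHE[Module.finrank ℝ E - 1] :=
  hf.integrableOn_of_subset_isCompact (isCompact_face b i)
    (isCompact_face b i).measurableSet le_rfl (measure_face_lt_top b hij).ne

end Simplex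

/-! ### The gradient theorem on a simplex. -/

section DivergenceSimplex

variable {E : Type*} [NormedAddCommGroup E] [InnerProductSpace ℝ E] [FiniteDimensional ℝ E]
variable {ι : Type*} [Fintype ι]

theorem coord_shift (b : AffineBasis ι ℝ E) (i j k : ι) (x : E) (s : ℝ) :
    b.coord k (x + s • (b j - b i))
      = b.coord k x + s * ((if k = j then 1 else 0) - (if k = i then 1 else 0)) := by
  rw [coord_add_smul, coord_linear_edge]

/-- Along `b j - b i` only two coordinates move: the `j`-th grows from zero and the `i`-th falls at
unit rate. The line therefore leaves the simplex when the `i`-th is used up. -/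
theorem edge_mem_solid_iff (b : AffineBasis ι ℝ E) {i j : ι} (hij : i ≠ j) {x : E}
    (hx : b.coord j x = 0) (s : ℝ) :
    x + s • (b j - b i) ∈ solid b ↔ x ∈ face b j ∧ s ∈ Icc 0 (b.coord i x) := by
  have hs := fun k => coord_shift b i j k x s
  constructor
  · intro h
    have hj := h j
    have hi := h i
    rw [hs] at hj hi
    simp only [if_true, hij, hij.symm, if_false] at hj hi
    refine ⟨⟨hx, fun k => ?_⟩, by linarith, by linarith⟩
    have hk := h k
    rw [hs] at hk
    by_cases hkj : k = j
    · rw [hkj, hx]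
    · by_cases hki : k = i
      · rw [hki]; linarith
      · simpa [hkj, hki] using hk
  · rintro ⟨⟨-, h⟩, h0, h1⟩ k
    have hk := h k
    rw [hs]
    by_cases hkj : k = j
    · subst hkj
      simp [hij.symm]; linarith
    · by_cases hki : k = i
      · subst hki
        simp [hij]; linarith
      · simpa [hkj, hki] using hk

/-- Moving from the facet opposite to `b j` to the facet opposite to `b i` along the edge. -/
theorem slide_mem_face_iff (b : AffineBasis ι ℝ E) {i j : ι} (hij : i ≠ j) {x : E}
    (hx : b.coord j x = 0) :
    x + b.coord i x • (b j - b i) ∈ face b i ↔ x ∈ face b j := by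
  have hs := fun k => coord_shift b i j k x (b.coord i x)
  have hi : b.coord i (x + b.coord i x • (b j - b i)) = 0 := by rw [hs]; simp [hij]
  constructor
  · intro h
    refine ⟨hx, fun k => ?_⟩
    have hk := h.2 k
    have hj := h.2 j
    rw [hs] at hj hk
    by_cases hkj : k = j
    · rw [hkj, hx]
    · by_cases hki : k = i
      · rw [hki]; simpa [hx, hij.symm] using hj
      · simpa [hkj, hki] using hk
  · intro h
    refine ⟨hi, ?_⟩
    exact ((edge_mem_solid_iff b hij hx _).2 ⟨h, h.2 i, le_rfl⟩)

/-- The fundamental theorem of calculus on the segment. The segment may run inside the boundary of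
the simplex, so the chain rule is applied within the simplex and becomes a two-sided derivative only
in the parameter. -/
theorem integral_fderivWithin_edge (b : AffineBasis ι ℝ E) {i j : ι} (hij : i ≠ j) {f : E → ℝ}
    (hf : ContDiffOn ℝ 1 f (solid b)) {x : E} (hx : x ∈ face b j) :
    ∫ s in Icc 0 (b.coord i x), fderivWithin ℝ f (solid b) (x + s • (b j - b i)) (b j - b i)
      = f (x + b.coord i x • (b j - b i)) - f x := by
  have hmem : ∀ s ∈ Icc 0 (b.coord i x), x + s • (b j - b i) ∈ solid b :=
    fun s hs => (edge_mem_solid_iff b hij hx.1 s).2 ⟨hx, hs⟩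
  have hcont : Continuous fun s : ℝ => x + s • (b j - b i) := by fun_prop
  rw [integral_Icc_eq_integral_Ioc, ← intervalIntegral.integral_of_le (hx.2 i)]
  rw [intervalIntegral.integral_eq_sub_of_hasDerivAt_of_le (hx.2 i)
    (f := fun s => f (x + s • (b j - b i)))]
  · simp
  · exact hf.continuousOn.comp hcont.continuousOn hmem
  · intro s hs
    have h1 : HasFDerivWithinAt f (fderivWithin ℝ f (solid b) (x + s • (b j - b i))) (solid b)
        (x + s • (b j - b i)) :=
      (hf.differentiableOn (by norm_num) _ (hmem s (Ioo_subset_Icc_self hs))).hasFDerivWithinAt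
    have h2 : HasDerivWithinAt (fun s : ℝ => x + s • (b j - b i)) (b j - b i)
        (Icc 0 (b.coord i x)) s := by
      simpa using (((hasDerivAt_id s).smul_const (b j - b i)).const_add x).hasDerivWithinAt
    exact (h1.comp_hasDerivWithinAt s h2 hmem).hasDerivAt (Icc_mem_nhds hs.1 hs.2)
  · apply ContinuousOn.intervalIntegrable
    rw [uIcc_of_le (hx.2 i)]
    exact ((hf.continuousOn_fderivWithin (uniqueDiffOn_solid b) (by norm_num)).comp
      hcont.continuousOn hmem).clm_apply continuousOn_const

variable [MeasurableSpace E] [BorelSpace E]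

theorem continuousOn_slide (b : AffineBasis ι ℝ E) {i j : ι} (hij : i ≠ j) {f : E → ℝ}
    (hf : ContinuousOn f (face b i)) :
    ContinuousOn (fun x => f (x + b.coord i x • (b j - b i))) (face b j) := by
  have hc : Continuous (b.coord i) := (b.coord i).continuous_of_finiteDimensional
  have : Continuous fun x => x + b.coord i x • (b j - b i) := by fun_prop
  exact hf.comp this.continuousOn fun x hx => (slide_mem_face_iff b hij hx.1).2 hx

theorem setIntegral_hyperplane_indicator_face (b : AffineBasis ι ℝ E) (i : ι) (f : E → ℝ)
    (μ : Measure E) :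
    ∫ x in {x | b.coord i x = 0}, (face b i).indicator f x ∂μ = ∫ x in face b i, f x ∂μ := by
  rw [setIntegral_indicator (isCompact_face b i).measurableSet]
  congr 2
  ext x
  exact ⟨fun h => h.2, fun h => ⟨h.1, h⟩⟩

theorem measurableSet_coord_eq_zero (b : AffineBasis ι ℝ E) (i : ι) :
    MeasurableSet {x | b.coord i x = 0} :=
  (isClosed_singleton.preimage (b.coord i).continuous_of_finiteDimensional).measurableSet

theorem abs_coord_linear_edge_left (b : AffineBasis ι ℝ E) {i j : ι} (hij : i ≠ j) :
    |(b.coord i).linear (b j - b i)| = 1 := by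
  rw [coord_linear_edge]; simp [hij]

theorem abs_coord_linear_edge_right (b : AffineBasis ι ℝ E) {i j : ι} (hij : i ≠ j) :
    |(b.coord j).linear (b j - b i)| = 1 := by
  rw [coord_linear_edge]; simp [hij.symm]

/-- Fubini over the lines parallel to an edge: each line meeting the simplex enters through the
facet opposite to `b j` and leaves through the one opposite to `b i`. -/
theorem integral_solid_fderivWithin_edge_slide (b : AffineBasis ι ℝ E) {i j : ι} (hij : i ≠ j)
    {f : E → ℝ} (hf : ContDiffOn ℝ 1 f (solid b)) :
    ∫ x in solid b, fderivWithin ℝ f (solid b) x (b j - b i)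
      = ‖coordGrad b j‖⁻¹ *
        (∫ x in face b j, f (x + b.coord i x • (b j - b i)) ∂μHE[Module.finrank ℝ E - 1]
          - ∫ x in face b j, f x ∂μHE[Module.finrank ℝ E - 1]) := by
  have hcont : ContinuousOn (fun x => fderivWithin ℝ f (solid b) x (b j - b i)) (solid b) :=
    (hf.continuousOn_fderivWithin (uniqueDiffOn_solid b) (by norm_num)).clm_apply
      continuousOn_const
  have hmeas := (isCompact_solid b).measurableSet
  rw [← integral_indicator hmeas, integral_eq_integral_coord_slices b hij.symm
    (abs_coord_linear_edge_right b hij)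
    ((integrable_indicator_iff hmeas).2 (hcont.integrableOn_compact (isCompact_solid b))),
    ← integral_sub (integrableOn_face b hij.symm
      (continuousOn_slide b hij (hf.continuousOn.mono (face_subset_solid b i))))
      (integrableOn_face b hij.symm (hf.continuousOn.mono (face_subset_solid b j))),
    ← setIntegral_hyperplane_indicator_face]
  congr 1
  refine setIntegral_congr_fun (measurableSet_coord_eq_zero b j) fun x hx => ?_
  by_cases hxF : x ∈ face b j
  · rw [indicator_of_mem hxF, ← integral_fderivWithin_edge b hij hf hxF,
      ← integral_indicator measurableSet_Icc]
    congr 1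
    ext s
    simp only [indicator]
    congr 1
    exact propext ((edge_mem_solid_iff b hij hx s).trans (and_iff_right hxF))
  · rw [indicator_of_notMem hxF]
    convert integral_zero ℝ ℝ with s
    exact indicator_of_notMem (fun h => hxF ((edge_mem_solid_iff b hij hx s).1 h).1) _

/-- Projecting one facet to another one along an edge changes the surface measure by the ratio of
the two heights. -/
theorem integral_face_slide (b : AffineBasis ι ℝ E) {i j : ι} (hij : i ≠ j) {f : E → ℝ}
    (hf : ContinuousOn f (face b i)) :
    ‖coordGrad b j‖⁻¹ *
        ∫ x in face b j, f (x + b.coord i x • (b j - b i)) ∂μHE[Module.finrank ℝ E - 1]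
      = ‖coordGrad b i‖⁻¹ * ∫ x in face b i, f x ∂μHE[Module.finrank ℝ E - 1] := by
  set e := b j - b i with he
  set π : E → E := fun x => x + b.coord i x • e with hπ
  have hc : Continuous (b.coord i) := (b.coord i).continuous_of_finiteDimensional
  have hπc : Continuous π := by fun_prop
  -- `A` is the prism swept by the facet opposite to `b i` under `s • e`, `0 ≤ s ≤ 1`. A line
  -- parallel to `e` meets it in a segment of parameter length one or not at all, and `f ∘ π` is
  -- constant on that line. Slicing the integral of `f ∘ π` over `A` by either hyperplane gives the
  -- two sides of the claim.
  set A : Set E := {x | b.coord i x ∈ Icc (-1) 0 ∧ π x ∈ face b i} with hA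
  have hci : ∀ (x : E) (s : ℝ), b.coord i (x + s • e) = b.coord i x - s := fun x s => by
    rw [coord_shift]; simp [hij]; ring
  have hπs : ∀ (x : E) (s : ℝ), π (x + s • e) = π x := fun x s => by
    simp only [hπ, hci, sub_smul]; abel
  have hAc : IsCompact A := by
    have himg : A = (fun q : E × ℝ => q.1 + q.2 • e) '' (face b i ×ˢ Icc 0 1) := by
      ext x
      constructor
      · rintro ⟨⟨h1, h2⟩, h3⟩
        exact ⟨(π x, -b.coord i x), ⟨h3, by constructor <;> simp <;> linarith⟩, by simp [hπ]⟩
      · rintro ⟨⟨y, s⟩, ⟨h1, h2, h3⟩, rfl⟩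
        have h10 : b.coord i y = 0 := h1.1
        refine ⟨?_, ?_⟩
        · rw [hci, h10]; simp only at h2 h3; constructor <;> linarith
        · simp only [hπs]
          simpa [hπ, h10] using h1
    rw [himg]
    exact ((isCompact_face b i).prod isCompact_Icc).image (by fun_prop)
  have hint : Integrable (A.indicator fun x => f (π x)) :=
    (integrable_indicator_iff hAc.measurableSet).2
      ((hf.comp hπc.continuousOn fun x hx => hx.2).integrableOn_compact hAc)
  have hslice : ∀ (x : E) (s : ℝ), A.indicator (fun x => f (π x)) (x + s • e)
      = (Icc (b.coord i x) (b.coord i x + 1)).indicator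
          (fun _ => ((face b i).indicator f (π x))) s := by
    intro x s
    have hmem : x + s • e ∈ A ↔ s ∈ Icc (b.coord i x) (b.coord i x + 1) ∧ π x ∈ face b i := by
      simp only [hA, mem_ofPred_eq, hπs, hci, mem_Icc]
      constructor
      · rintro ⟨⟨h1, h2⟩, h3⟩; exact ⟨⟨by linarith, by linarith⟩, h3⟩
      · rintro ⟨⟨h1, h2⟩, h3⟩; exact ⟨⟨by linarith, by linarith⟩, h3⟩
    simp only [indicator, hmem, hπs]
    split_ifs <;> simp_all
  have hinner : ∀ x : E, ∫ s : ℝ, A.indicator (fun x => f (π x)) (x + s • e)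
      = (face b i).indicator f (π x) := fun x => by
    simp only [hslice]
    rw [integral_indicator measurableSet_Icc]
    simp
  have h1 := integral_eq_integral_coord_slices b hij (abs_coord_linear_edge_left b hij) hint
  have h2 := integral_eq_integral_coord_slices b hij.symm (abs_coord_linear_edge_right b hij) hint
  rw [← he] at h1 h2
  simp only [hinner] at h1 h2
  rw [h1] at h2
  rw [← setIntegral_hyperplane_indicator_face b i, ← setIntegral_hyperplane_indicator_face b j]
  convert h2.symm using 2
  · refine setIntegral_congr_fun (measurableSet_coord_eq_zero b j) fun x hx => ?_
    simp only [indicator, ← slide_mem_face_iff b hij hx, hπ, he]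
  · refine setIntegral_congr_fun (measurableSet_coord_eq_zero b i) fun x hx => ?_
    have hx0 : b.coord i x = 0 := hx
    simp [hπ, hx0]

theorem integral_solid_fderivWithin_edge (b : AffineBasis ι ℝ E) (i j : ι)
    {f : E → ℝ} (hf : ContDiffOn ℝ 1 f (solid b)) :
    ∫ x in solid b, fderivWithin ℝ f (solid b) x (b j - b i)
      = ‖coordGrad b i‖⁻¹ * ∫ x in face b i, f x ∂μHE[Module.finrank ℝ E - 1]
        - ‖coordGrad b j‖⁻¹ * ∫ x in face b j, f x ∂μHE[Module.finrank ℝ E - 1] := by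
  by_cases hij : i = j
  · subst hij; simp
  rw [integral_solid_fderivWithin_edge_slide b hij hf, mul_sub,
    integral_face_slide b hij (hf.continuousOn.mono (face_subset_solid b i))]

/-- The gradient theorem on a simplex. -/
theorem integral_solid_fderivWithin (b : AffineBasis ι ℝ E) {f : E → ℝ}
    (hf : ContDiffOn ℝ 1 f (solid b)) (v : E) :
    ∫ x in solid b, fderivWithin ℝ f (solid b) x v
      = -∑ k, (b.coord k).linear v *
          (‖coordGrad b k‖⁻¹ * ∫ x in face b k, f x ∂μHE[Module.finrank ℝ E - 1]) := by
  obtain ⟨i⟩ : Nonempty ι := b.nonempty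
  -- The linear parts of the coordinates sum to zero, so any vector is a combination of the edges at
  -- one vertex `b i`. For the same reason the contributions of the facet opposite to `b i` cancel
  -- at the end.
  have hv : v = ∑ k, (b.coord k).linear v • (b k - b i) := by
    simp only [smul_sub, Finset.sum_sub_distrib, ← Finset.sum_smul, sum_coord_linear, zero_smul,
      sub_zero, sum_coord_linear_smul]
  have hcont := hf.continuousOn_fderivWithin (uniqueDiffOn_solid b) (by norm_num)
  have hlin : ∀ x, fderivWithin ℝ f (solid b) x v
      = ∑ k, (b.coord k).linear v * fderivWithin ℝ f (solid b) x (b k - b i) := fun x => by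
    conv_lhs => rw [hv]
    simp
  simp only [hlin]
  rw [integral_finsetSum _ fun k _ => Integrable.const_mul
    ((hcont.clm_apply continuousOn_const).integrableOn_compact (isCompact_solid b)) _]
  simp only [integral_const_mul, integral_solid_fderivWithin_edge b i _ hf, mul_sub,
    Finset.sum_sub_distrib, ← Finset.sum_mul, sum_coord_linear, zero_mul, zero_sub]

end DivergenceSimplex

/-! ### Facets have positive measure and their lower-dimensional faces are null. -/

section BoundaryNull

variable {E : Type*} [NormedAddCommGroup E] [InnerProductSpace ℝ E] [FiniteDimensional ℝ E]
  [MeasurableSpace E] [BorelSpace E] {ι : Type*} [Fintype ι]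

/-- In the chart centred at `b j`, the second condition cuts out a proper affine subspace, because
the `j`-th coordinate equals one at the origin of the chart. Such a subspace is Lebesgue null. -/
theorem measure_face_inter_coord_eq_zero (b : AffineBasis ι ℝ E) {i j : ι} (hij : i ≠ j) :
    μHE[Module.finrank ℝ E - 1] (face b i ∩ {x | b.coord j x = 0}) = 0 := by
  have h0 : ‖coordGrad b i‖ ≠ 0 := norm_ne_zero_iff.2 (coordGrad_ne_zero b hij)
  set n := ‖coordGrad b i‖⁻¹ • coordGrad b i with hndef
  have hn : ‖n‖ = 1 := by
    rw [hndef, norm_smul, norm_inv, norm_norm, inv_mul_cancel₀ h0]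
  have h := map_volume_hyperplane (b j) hn
  rw [hyperplane_coordGrad b hij] at h
  have hm := ((isCompact_face b i).measurableSet.inter (measurableSet_coord_eq_zero b j))
  have hsub : (face b i ∩ {x | b.coord j x = 0}) ∩ {x | b.coord i x = 0}
      = face b i ∩ {x | b.coord j x = 0} := inter_eq_left.2 fun x hx => hx.1.1
  rw [← hsub, ← Measure.restrict_apply hm, ← h]
  rw [(isometry_hyperplane (b j) n).isClosedEmbedding.measurableEmbedding.map_apply]
  set φ : (ℝ ∙ n)ᗮ →ᵃ[ℝ] ℝ := (b.coord j).comp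
    ((AffineMap.const ℝ _ (b j)) + (Submodule.subtype _).toAffineMap) with hφ
  have hφa : ∀ y : (ℝ ∙ n)ᗮ, φ y = b.coord j (b j + (y : E)) := fun y => by simp [hφ]
  refine measure_mono_null (t := ((AffineSubspace.mk' (0 : ℝ) ⊥).comap φ : Set _)) ?_ ?_
  · intro y hy
    have : b.coord j (b j + (y : E)) = 0 := hy.2
    simp [AffineSubspace.mem_mk', hφa, this]
  · refine Measure.addHaar_affineSubspace _ _ fun htop => ?_
    have : (0 : (ℝ ∙ n)ᗮ) ∈ ((AffineSubspace.mk' (0 : ℝ) ⊥).comap φ) := by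
      rw [htop]; exact AffineSubspace.mem_top _ _ _
    simp [AffineSubspace.mem_mk', hφa] at this

/-- If the facet were null, the slicing formula applied to the linear part of the `j`-th coordinate,
whose derivative along the edge is one, would give the solid simplex volume zero. -/
theorem measure_face_ne_zero (b : AffineBasis ι ℝ E) {i j : ι} (hij : i ≠ j) :
    μHE[Module.finrank ℝ E - 1] (face b j) ≠ 0 := by
  intro h0
  have h := integral_solid_fderivWithin_edge_slide b hij
    (f := innerSL ℝ (coordGrad b j)) (innerSL ℝ (coordGrad b j)).contDiff.contDiffOn
  rw [Measure.restrict_eq_zero.2 h0] at h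
  simp only [integral_zero_measure, sub_zero, mul_zero] at h
  have hc : ∀ x ∈ solid b, fderivWithin ℝ (innerSL ℝ (coordGrad b j)) (solid b) x (b j - b i)
      = 1 := fun x hx => by
    rw [ContinuousLinearMap.fderivWithin _ (uniqueDiffOn_solid b x hx), innerSL_apply_apply,
      inner_coordGrad, coord_linear_edge]
    simp [hij.symm]
  rw [setIntegral_congr_fun (isCompact_solid b).measurableSet hc] at h
  simp only [integral_const, smul_eq_mul, mul_one, measureReal_restrict_apply_univ] at h
  rw [measureReal_eq_zero_iff (isCompact_solid b).measure_lt_top.ne] at h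
  have := measure_mono_null interior_subset h
  exact (isOpen_interior.measure_pos volume (interior_solid_nonempty b)).ne' this

end BoundaryNull

/-! ### Locality and opposition of outward normals. -/

variable {d : ℕ}

theorem IsOuterNormalAt.congr {U V : Set (Pt d)} {x ν : Pt d} (h : IsOuterNormalAt U x ν)
    (hUV : ∀ᶠ y in nhds x, y ∈ U ↔ y ∈ V) : IsOuterNormalAt V x ν := by
  obtain ⟨h1, r, hr, h2⟩ := h
  obtain ⟨r', hr', h3⟩ := Metric.eventually_nhds_iff_ball.1 hUV
  refine ⟨h1, min r r', lt_min hr hr', fun y hy => ?_⟩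
  rw [← h3 y (Metric.ball_subset_ball (min_le_right _ _) hy),
    h2 y (Metric.ball_subset_ball (min_le_left _ _) hy)]

theorem IsOuterNormalAt.notMem {U : Set (Pt d)} {x ν : Pt d} (h : IsOuterNormalAt U x ν) :
    x ∉ U := by
  obtain ⟨-, r, hr, h2⟩ := h
  rw [h2 x (Metric.mem_ball_self hr)]
  simp

/-- Two disjoint sets have opposite normals. -/
theorem IsOuterNormalAt.eq_neg {U V : Set (Pt d)} {x ν ν' : Pt d} (h : IsOuterNormalAt U x ν)
    (h' : IsOuterNormalAt V x ν') (hd : Disjoint U V) : ν' = -ν := by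
  obtain ⟨h1, r, hr, h2⟩ := h
  obtain ⟨h1', r', hr', h2'⟩ := h'
  by_contra hne
  have hlt : inner ℝ (-ν) ν' < 1 := (inner_lt_one_iff_real_of_norm_eq_one (by simpa) h1').2
    (Ne.symm hne)
  rw [inner_neg_left] at hlt
  have hlt' : -inner ℝ ν' ν < 1 := by rwa [real_inner_comm]
  -- If `ν' ≠ -ν`, the vector `ν + ν'` has positive inner product `1 + ⟨ν, ν'⟩` with both normals. A
  -- small step backwards along it enters both half spaces, hence both sets.
  obtain ⟨e, he, hb⟩ : ∃ e > (0 : ℝ), ‖e • (ν + ν')‖ < min r r' := by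
    refine ⟨min r r' / (‖ν + ν'‖ + 1), by positivity, ?_⟩
    rw [norm_smul, Real.norm_of_nonneg (by positivity), div_mul_eq_mul_div,
      div_lt_iff₀ (by positivity)]
    have : 0 < min r r' := lt_min hr hr'
    nlinarith
  have hmem : x - e • (ν + ν') ∈ U ∩ V := by
    constructor
    · refine (h2 _ ?_).2 ?_
      · simpa [Metric.mem_ball, dist_eq_norm] using hb.trans_le (min_le_left _ _)
      · rw [sub_sub_cancel_left, inner_neg_left, real_inner_smul_left, inner_add_left,
          real_inner_self_eq_norm_sq, h1]
        nlinarith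
    · refine (h2' _ ?_).2 ?_
      · simpa [Metric.mem_ball, dist_eq_norm] using hb.trans_le (min_le_right _ _)
      · rw [sub_sub_cancel_left, inner_neg_left, real_inner_smul_left, inner_add_left,
          real_inner_self_eq_norm_sq, h1']
        nlinarith
  exact hd.le_bot hmem

/-! ### Simplices given by their vertices: faces, normals, divergence theorem. -/

/-- `K` is the vertex set of a nondegenerate `d`-simplex. -/
structure IsSimplex (K : Finset (Pt d)) : Prop where
  card : K.card = d + 1
  indep : AffineIndependent ℝ ((↑) : K → Pt d)

/-- The affine basis formed by the vertices. -/
def IsSimplex.basis {K : Finset (Pt d)} (h : IsSimplex K) : AffineBasis K ℝ (Pt d) :=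
  ⟨(↑), h.indep, by
    rw [h.indep.affineSpan_eq_top_iff_card_eq_finrank_add_one]
    simp [h.card]⟩

variable {K : Finset (Pt d)}

theorem IsSimplex.basis_apply (h : IsSimplex K) (v : K) : h.basis v = v := rfl

theorem IsSimplex.range_basis (h : IsSimplex K) : range h.basis = K := by
  ext x; simp [h.basis_apply]

theorem IsSimplex.hull_eq (h : IsSimplex K) : hull K = solid h.basis := by
  rw [solid_eq_convexHull, h.range_basis, hull]

/-- A point of a face has zero weight on the other vertices, and conversely the barycentric
combination then involves only `S`. This turns the incidence arguments below into statements about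
vanishing coordinates. -/
theorem IsSimplex.mem_hull_iff (h : IsSimplex K) {S : Finset (Pt d)} (hS : S ⊆ K) {x : Pt d} :
    x ∈ hull S ↔ (∀ k, 0 ≤ h.basis.coord k x) ∧ ∀ k : K, (k : Pt d) ∉ S → h.basis.coord k x = 0 := by
  constructor
  · intro hx
    have hxK : x ∈ hull K := convexHull_mono (by exact_mod_cast hS) hx
    refine ⟨by rw [h.hull_eq] at hxK; exact hxK, fun k hk => ?_⟩
    have hsub : hull S ⊆ h.basis.coord k ⁻¹' {0} := by
      refine convexHull_min (fun s hs => ?_) ((convex_singleton 0).affine_preimage _)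
      have hsK : s ∈ K := hS hs
      have := h.basis.coord_apply k ⟨s, hsK⟩
      rw [h.basis_apply] at this
      rw [mem_preimage, this, if_neg]
      · rfl
      · rintro rfl; exact hk hs
    exact hsub hx
  · rintro ⟨h0, h1⟩
    rw [← h.basis.linear_combination_coord_eq_self x]
    have hsum := h.basis.sum_coord_apply_eq_one x
    have e1 : ∑ i : K, h.basis.coord i x • h.basis i
        = ∑ i ∈ Finset.univ.filter (fun i : K => (i : Pt d) ∈ S), h.basis.coord i x • h.basis i := by
      refine (Finset.sum_filter_of_ne fun i _ hi => ?_).symm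
      by_contra hiS
      exact hi (by rw [h1 i hiS, zero_smul])
    have e2 : ∑ i : K, h.basis.coord i x
        = ∑ i ∈ Finset.univ.filter (fun i : K => (i : Pt d) ∈ S), h.basis.coord i x := by
      refine (Finset.sum_filter_of_ne fun i _ hi => ?_).symm
      by_contra hiS
      exact hi (h1 i hiS)
    rw [e1]
    refine (convex_convexHull ℝ _).sum_mem (fun i _ => h0 i) (e2 ▸ hsum) fun i hi => ?_
    exact subset_convexHull ℝ _ (Finset.mem_filter.1 hi).2

theorem IsSimplex.face_eq (h : IsSimplex K) (v : K) : face h.basis v = hull (K.erase v) := by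
  ext x
  rw [h.mem_hull_iff (Finset.erase_subset _ _)]
  constructor
  · rintro ⟨h1, h2⟩
    refine ⟨h2, fun k hk => ?_⟩
    have : k = v := by
      by_contra hne
      exact hk (Finset.mem_erase.2 ⟨fun h => hne (Subtype.ext h), k.2⟩)
    rw [this, h1]
  · rintro ⟨h1, h2⟩
    exact ⟨h2 v (Finset.notMem_erase _ _), h1⟩

theorem IsSimplex.facetsOf_eq (h : IsSimplex K) : facetsOf K = K.image fun v => K.erase v := by
  ext F
  rw [facetsOf, Finset.mem_powersetCard, Finset.mem_image]
  constructor
  · rintro ⟨hF, hc⟩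
    have : (K \ F).card = 1 := by rw [Finset.card_sdiff_of_subset hF, h.card, hc]; omega
    obtain ⟨v, hv⟩ := Finset.card_eq_one.1 this
    have hvK : v ∈ K \ F := by rw [hv]; simp
    refine ⟨v, (Finset.mem_sdiff.1 hvK).1, ?_⟩
    rw [Finset.erase_eq, ← hv, Finset.sdiff_sdiff_eq_self hF]
  · rintro ⟨v, hv, rfl⟩
    exact ⟨Finset.erase_subset _ _, by rw [Finset.card_erase_of_mem hv, h.card]; omega⟩

theorem IsSimplex.sum_facetsOf (h : IsSimplex K) (φ : Finset (Pt d) → ℝ) :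
    ∑ F ∈ facetsOf K, φ F = ∑ v : K, φ (K.erase v) := by
  rw [h.facetsOf_eq, Finset.sum_image, ← Finset.sum_coe_sort]
  intro v hv w hw hvw
  by_contra hne
  have : v ∈ K.erase w := Finset.mem_erase.2 ⟨hne, hv⟩
  rw [← show K.erase v = K.erase w from hvw] at this
  simp at this

theorem IsSimplex.exists_of_mem_facetsOf (h : IsSimplex K) {F : Finset (Pt d)}
    (hF : F ∈ facetsOf K) : ∃ v : K, F = K.erase v := by
  rw [h.facetsOf_eq, Finset.mem_image] at hF
  obtain ⟨v, hv, rfl⟩ := hF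
  exact ⟨⟨v, hv⟩, rfl⟩

/-- The relative interior of the simplex with vertex set `F`. -/
def core (F : Finset (Pt d)) : Set (Pt d) := {x | x ∈ hull F ∧ ∀ v ∈ F, x ∉ hull (F.erase v)}

theorem IsSimplex.coord_pos_of_mem_core (h : IsSimplex K) {v : K} {x : Pt d}
    (hx : x ∈ core (K.erase v)) {k : K} (hk : k ≠ v) : 0 < h.basis.coord k x := by
  have h1 := (h.mem_hull_iff (Finset.erase_subset _ _)).1 hx.1
  have hkm : (k : Pt d) ∈ K.erase v := Finset.mem_erase.2 ⟨fun h => hk (Subtype.ext h), k.2⟩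
  refine lt_of_le_of_ne (h1.1 k) fun h0 => hx.2 k hkm ?_
  rw [h.mem_hull_iff ((Finset.erase_subset _ _).trans (Finset.erase_subset _ _))]
  refine ⟨h1.1, fun l hl => ?_⟩
  by_cases hlk : l = k
  · rw [hlk, ← h0]
  · refine h1.2 l fun hl' => hl (Finset.mem_erase.2 ⟨fun h => hlk (Subtype.ext h), hl'⟩)

theorem IsSimplex.coord_eq_zero_of_mem_core (h : IsSimplex K) {v : K} {x : Pt d}
    (hx : x ∈ core (K.erase v)) : h.basis.coord v x = 0 :=
  ((h.mem_hull_iff (Finset.erase_subset _ _)).1 hx.1).2 v (Finset.notMem_erase _ _)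

/-- The outward normal to the facet opposite to `v`. -/
def IsSimplex.normal (h : IsSimplex K) (v : K) : Pt d :=
  -(‖coordGrad h.basis v‖⁻¹ • coordGrad h.basis v)

theorem IsSimplex.nontrivial (h : IsSimplex K) (hd : 0 < d) (v : K) : ∃ u : K, v ≠ u := by
  have : 1 < Fintype.card K := by simp [h.card, hd]
  obtain ⟨u, hu⟩ := Fintype.exists_ne_of_one_lt_card this v
  exact ⟨u, hu.symm⟩

/-- In the relative interior of a facet all coordinates except that of `v` are positive, and they
stay so nearby. Locally the open simplex is thus cut out by the single inequality that the
coordinate of `v` be positive. -/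
theorem IsSimplex.isOuterNormalAt (h : IsSimplex K) (hd : 0 < d) {v : K} {x : Pt d}
    (hx : x ∈ core (K.erase v)) : IsOuterNormalAt (interior (hull K)) x (h.normal v) := by
  obtain ⟨u, hu⟩ := h.nontrivial hd v
  have h0 : ‖coordGrad h.basis v‖ ≠ 0 := norm_ne_zero_iff.2 (coordGrad_ne_zero _ hu)
  refine ⟨by rw [IsSimplex.normal, norm_neg, norm_smul, norm_inv, norm_norm, inv_mul_cancel₀ h0], ?_⟩
  have hev : ∀ᶠ y in nhds x, ∀ k : K, k ≠ v → 0 < h.basis.coord k y := by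
    refine Filter.eventually_all.2 fun k => ?_
    by_cases hk : k = v
    · simp [hk]
    · have hc : Continuous (h.basis.coord k) := (h.basis.coord k).continuous_of_finiteDimensional
      filter_upwards [hc.continuousAt.eventually (lt_mem_nhds (h.coord_pos_of_mem_core hx hk))]
        with y hy _ using hy
  obtain ⟨r, hr, hball⟩ := Metric.eventually_nhds_iff_ball.1 hev
  refine ⟨r, hr, fun y hy => ?_⟩
  have hin : inner ℝ (y - x) (h.normal v) = -(‖coordGrad h.basis v‖⁻¹ * h.basis.coord v y) := by
    rw [IsSimplex.normal, inner_neg_right, real_inner_smul_right, real_inner_comm, inner_coordGrad,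
      coord_linear_sub, h.coord_eq_zero_of_mem_core hx, sub_zero]
  rw [hin, h.hull_eq, interior_solid, mem_ofPred_eq]
  have hpos : 0 < ‖coordGrad h.basis v‖⁻¹ := by positivity
  constructor
  · intro hall
    have := mul_pos hpos (hall v)
    linarith
  · intro hneg k
    by_cases hk : k = v
    · rw [hk]
      exact (mul_pos_iff_of_pos_left hpos).1 (by linarith)
    · exact hball y hy k hk

theorem IsSimplex.cellNormal_eq (h : IsSimplex K) (hd : 0 < d) {v : K} {x : Pt d}
    (hx : x ∈ core (K.erase v)) : cellNormal K x = h.normal v :=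
  (h.isOuterNormalAt hd hx).outerNormal_eq

theorem IsSimplex.isOuterNormalAt_cellNormal (h : IsSimplex K) (hd : 0 < d) {F : Finset (Pt d)}
    (hF : F ∈ facetsOf K) {x : Pt d} (hx : x ∈ core F) :
    IsOuterNormalAt (interior (hull K)) x (cellNormal K x) := by
  obtain ⟨v, rfl⟩ := h.exists_of_mem_facetsOf hF
  rw [h.cellNormal_eq hd hx]
  exact h.isOuterNormalAt hd hx

theorem isCompact_hull (F : Finset (Pt d)) : IsCompact (hull F) :=
  F.finite_toSet.isCompact_convexHull (𝕜 := ℝ)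

theorem measurableSet_hull (F : Finset (Pt d)) : MeasurableSet (hull F) :=
  (isCompact_hull F).measurableSet

theorem IsSimplex.measure_hull_diff_core (h : IsSimplex K) {F : Finset (Pt d)}
    (hF : F ∈ facetsOf K) : μHE[d - 1] (hull F \ core F) = 0 := by
  obtain ⟨v, rfl⟩ := h.exists_of_mem_facetsOf hF
  have hsub : hull (K.erase v) \ core (K.erase v)
      ⊆ ⋃ u : {u : K // v ≠ u}, face h.basis v ∩ {x | h.basis.coord u x = 0} := by
    rintro x ⟨hx, hxc⟩
    have : ∃ u ∈ K.erase v, x ∈ hull ((K.erase v).erase u) := by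
      by_contra hno
      push Not at hno
      exact hxc ⟨hx, hno⟩
    obtain ⟨u, hu, hxu⟩ := this
    obtain ⟨huv, huK⟩ := Finset.mem_erase.1 hu
    refine mem_iUnion.2 ⟨⟨⟨u, huK⟩, fun h => huv (by rw [h])⟩, ?_, ?_⟩
    · rw [h.face_eq]; exact hx
    · exact ((h.mem_hull_iff ((Finset.erase_subset _ _).trans (Finset.erase_subset _ _))).1 hxu).2
        ⟨u, huK⟩ (Finset.notMem_erase _ _)
  refine measure_mono_null hsub (measure_iUnion_null fun u => ?_)
  have := measure_face_inter_coord_eq_zero h.basis u.2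
  simpa using this

theorem IsSimplex.measure_facet_ne_zero (h : IsSimplex K) (hd : 0 < d) {F : Finset (Pt d)}
    (hF : F ∈ facetsOf K) : μHE[d - 1] (hull F) ≠ 0 := by
  obtain ⟨v, rfl⟩ := h.exists_of_mem_facetsOf hF
  obtain ⟨u, hu⟩ := h.nontrivial hd v
  have := measure_face_ne_zero h.basis hu.symm
  rw [h.face_eq] at this
  simpa using this

theorem IsSimplex.integrableOn_facet (h : IsSimplex K) (hd : 0 < d) {F : Finset (Pt d)}
    (hF : F ∈ facetsOf K) {f : Pt d → ℝ} (hf : ContinuousOn f (hull F)) :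
    IntegrableOn f (hull F) μHE[d - 1] := by
  obtain ⟨v, rfl⟩ := h.exists_of_mem_facetsOf hF
  obtain ⟨u, hu⟩ := h.nontrivial hd v
  rw [← h.face_eq] at hf ⊢
  have := integrableOn_face h.basis hu hf
  simpa using this

theorem IsSimplex.ae_core (h : IsSimplex K) {F : Finset (Pt d)} (hF : F ∈ facetsOf K) :
    ∀ᵐ x ∂(μHE[d - 1]).restrict (hull F), x ∈ core F := by
  rw [ae_iff, Measure.restrict_apply₀']
  · rw [inter_comm]
    exact h.measure_hull_diff_core hF
  · exact (measurableSet_hull F).nullMeasurableSet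

theorem IsSimplex.facetInt_congr (h : IsSimplex K) {F : Finset (Pt d)} (hF : F ∈ facetsOf K)
    {f g : Pt d → ℝ} (hfg : ∀ x ∈ core F, f x = g x) : facetInt F f = facetInt F g := by
  refine integral_congr_ae ?_
  filter_upwards [h.ae_core hF] with x hx using hfg x hx

/-- Integrals with the normal of the element, which is constant on the facet. -/
theorem IsSimplex.facetInt_inner_normal (h : IsSimplex K) (hd : 0 < d) (v : K) (w : Pt d → Pt d) :
    facetInt (K.erase v) (fun x => inner ℝ (w x) (cellNormal K x))
      = facetInt (K.erase v) (fun x => inner ℝ (w x) (h.normal v)) := by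
  refine h.facetInt_congr ?_ fun x hx => by rw [h.cellNormal_eq hd hx]
  rw [h.facetsOf_eq]
  exact Finset.mem_image_of_mem _ v.2

/-- The divergence theorem on a simplex. -/
theorem IsSimplex.cellInt_divg (h : IsSimplex K) (hd : 0 < d) {w : Pt d → Pt d}
    (hw : ∀ i, ContDiffOn ℝ 1 (fun x => w x i) (hull K)) :
    cellInt K (divg (hull K) w) = bdryInt K fun _ x => inner ℝ (w x) (cellNormal K x) := by
  rw [bdryInt, h.sum_facetsOf (fun F => facetInt F fun x => inner ℝ (w x) (cellNormal K x))]
  simp only [h.facetInt_inner_normal hd]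
  simp only [cellInt, divg, pd]
  rw [h.hull_eq] at hw ⊢
  rw [integral_finsetSum]
  swap
  · intro i _
    exact (((hw i).continuousOn_fderivWithin (uniqueDiffOn_solid _) (by norm_num)).clm_apply
      continuousOn_const).integrableOn_compact (isCompact_solid _)
  have hg := fun i => integral_solid_fderivWithin h.basis (hw i) (EuclideanSpace.single i 1)
  simp only [finrank_euclideanSpace, Fintype.card_fin] at hg
  simp only [hg]
  rw [Finset.sum_neg_distrib, Finset.sum_comm, ← Finset.sum_neg_distrib]
  refine Finset.sum_congr rfl fun v _ => ?_
  obtain ⟨u, hu⟩ := h.nontrivial hd v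
  have hn : ∀ i, (h.normal v) i
      = -(‖coordGrad h.basis v‖⁻¹ * (h.basis.coord v).linear (EuclideanSpace.single i 1)) := by
    intro i
    rw [← inner_coordGrad, IsSimplex.normal]
    simp [EuclideanSpace.inner_single_right]
  have hin : ∀ x, inner ℝ (w x) (h.normal v) = ∑ i, (h.normal v) i * w x i := fun x => by
    simp [PiLp.inner_apply]
  simp only [facetInt, hin, ← h.face_eq]
  rw [integral_finsetSum]
  · rw [← Finset.sum_neg_distrib]
    refine Finset.sum_congr rfl fun i _ => ?_
    rw [integral_const_mul, hn]
    ring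
  · intro i _
    refine Integrable.const_mul ?_ _
    have := integrableOn_face h.basis hu ((hw i).continuousOn.mono (face_subset_solid _ v))
    simpa [IntegrableOn] using this

theorem IsSimplex.core_nonempty {K : Finset (Pt d)} (h : IsSimplex K) (hd : 0 < d)
    {F : Finset (Pt d)} (hF : F ∈ facetsOf K) : (core F).Nonempty := by
  by_contra hne
  rw [not_nonempty_iff_eq_empty] at hne
  have := h.measure_hull_diff_core hF
  rw [hne, sdiff_empty] at this
  exact h.measure_facet_ne_zero hd hF this

theorem subset_of_mem_facetsOf {K F : Finset (Pt d)} (hF : F ∈ facetsOf K) : F ⊆ K :=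
  (Finset.mem_powersetCard.1 hF).1

/-! ### Incidence of facets and elements in a conforming triangulation. -/

namespace IsTriangulation

variable {U : Set (Pt d)} {T : Finset (Finset (Pt d))} {L M F : Finset (Pt d)}

theorem isSimplex (h : IsTriangulation U T) (hK : K ∈ T) : IsSimplex K :=
  ⟨h.card K hK, h.indep K hK⟩

theorem hull_subset_closure (h : IsTriangulation U T) (hK : K ∈ T) : hull K ⊆ closure U := by
  rw [← h.cover]
  exact subset_biUnion_of_mem (u := fun K => hull K) hK

/-- Conformity puts `x` in the face spanned by `K ∩ L`. If a vertex of `F` were missing from `L`,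
its coordinate would vanish at `x`, contrary to `x` being in the relative interior of `F`. -/
theorem mem_facetsOf_of_mem_core (h : IsTriangulation U T) (hK : K ∈ T) (hL : L ∈ T)
    (hF : F ∈ facetsOf K) {x : Pt d} (hx : x ∈ core F) (hxL : x ∈ hull L) : F ∈ facetsOf L := by
  have hs := h.isSimplex hK
  have hFK := subset_of_mem_facetsOf hF
  refine Finset.mem_powersetCard.2 ⟨fun v hv => ?_, (Finset.mem_powersetCard.1 hF).2⟩
  by_contra hvL
  have hxK : x ∈ hull K := convexHull_mono (by exact_mod_cast hFK) hx.1
  have hxKL : x ∈ hull (K ∩ L) := by rw [← h.conforming K hK L hL]; exact ⟨hxK, hxL⟩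
  have h1 := (hs.mem_hull_iff hFK).1 hx.1
  have h2 := (hs.mem_hull_iff Finset.inter_subset_left).1 hxKL
  refine hx.2 v hv ((hs.mem_hull_iff ((Finset.erase_subset _ _).trans hFK)).2 ⟨h1.1, fun k hk => ?_⟩)
  by_cases hkv : (k : Pt d) = v
  · exact h2.2 k fun hmem => hvL (hkv ▸ (Finset.mem_inter.1 hmem).2)
  · exact h1.2 k fun hmem => hk (Finset.mem_erase.2 ⟨hkv, hmem⟩)

/-- A common point lies in the face of shared vertices, where the coordinate of some vertex of `K`
outside `L` is zero; interior points have all coordinates positive. -/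
theorem disjoint_interior (h : IsTriangulation U T) (hK : K ∈ T) (hL : L ∈ T) (hKL : K ≠ L) :
    Disjoint (interior (hull K)) (interior (hull L)) := by
  have hs := h.isSimplex hK
  rw [Set.disjoint_left]
  intro x hxK hxL
  have hxKL : x ∈ hull (K ∩ L) := by
    rw [← h.conforming K hK L hL]; exact ⟨interior_subset hxK, interior_subset hxL⟩
  have hnot : ¬K ⊆ L := fun hsub =>
    hKL (Finset.eq_of_subset_of_card_le hsub (by rw [h.card K hK, h.card L hL]))
  obtain ⟨v, hvK, hvL⟩ := Finset.not_subset.1 hnot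
  have h0 := ((hs.mem_hull_iff Finset.inter_subset_left).1 hxKL).2 ⟨v, hvK⟩
    fun hmem => hvL (Finset.mem_inter.1 hmem).2
  rw [hs.hull_eq, interior_solid] at hxK
  exact (hxK ⟨v, hvK⟩).ne' h0

theorem cellNormal_eq_neg (h : IsTriangulation U T) (hd : 0 < d) (hK : K ∈ T) (hL : L ∈ T)
    (hKL : K ≠ L) (hFK : F ∈ facetsOf K) (hFL : F ∈ facetsOf L) {x : Pt d} (hx : x ∈ core F) :
    cellNormal L x = -cellNormal K x :=
  ((h.isSimplex hK).isOuterNormalAt_cellNormal hd hFK hx).eq_neg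
    ((h.isSimplex hL).isOuterNormalAt_cellNormal hd hFL hx) (h.disjoint_interior hK hL hKL)

/-- A facet belongs to at most two elements. -/
theorem eq_or_eq_of_mem_facetsOf (h : IsTriangulation U T) (hd : 0 < d) (hK : K ∈ T) (hL : L ∈ T)
    (hM : M ∈ T) (hKL : K ≠ L) (hFK : F ∈ facetsOf K) (hFL : F ∈ facetsOf L)
    (hFM : F ∈ facetsOf M) : M = K ∨ M = L := by
  by_contra hne
  push Not at hne
  obtain ⟨x, hx⟩ := (h.isSimplex hK).core_nonempty hd hFK
  -- Three elements at one facet would have pairwise opposite normals, forcing a unit vector to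
  -- equal its own negative.
  have h1 := h.cellNormal_eq_neg hd hK hL hKL hFK hFL hx
  have h2 := h.cellNormal_eq_neg hd hK hM hne.1.symm hFK hFM hx
  have h3 := h.cellNormal_eq_neg hd hL hM hne.2.symm hFL hFM hx
  rw [h3, h1] at h2
  have h4 := ((h.isSimplex hK).isOuterNormalAt_cellNormal hd hFK hx).1
  have h5 : cellNormal K x = 0 := by
    rw [neg_neg] at h2
    have h6 : (2 : ℝ) • cellNormal K x = 0 := by
      rw [two_smul]
      nth_rewrite 1 [h2]
      exact neg_add_cancel _
    exact (smul_eq_zero.1 h6).resolve_left two_ne_zero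
  simp [h5] at h4

/-- A facet of a single element lies on the boundary. -/
theorem isOuterNormalAt (h : IsTriangulation U T) (hd : 0 < d) (hU : interior (closure U) = U)
    (hK : K ∈ T) (hF : F ∈ facetsOf K) (huniq : ∀ L ∈ T, F ∈ facetsOf L → L = K) {x : Pt d}
    (hx : x ∈ core F) : IsOuterNormalAt U x (cellNormal K x) := by
  refine ((h.isSimplex hK).isOuterNormalAt_cellNormal hd hF hx).congr ?_
  -- The other elements are finitely many closed sets missing `x`, so near `x` the closure of `U` is
  -- just `hull K`. Regularity of `U` lets interiors be compared instead of closures.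
  have hev : ∀ᶠ y in nhds x, ∀ L ∈ T, L ≠ K → y ∉ hull L := by
    refine (Filter.eventually_all_finset T).2 fun L hL => ?_
    by_cases hLK : L = K
    · simp [hLK]
    · have hxL : x ∈ (hull L)ᶜ := fun hxL =>
        hLK (huniq L hL (h.mem_facetsOf_of_mem_core hK hL hF hx hxL))
      filter_upwards [(isCompact_hull L).isClosed.isOpen_compl.mem_nhds hxL] with y hy _ using hy
  have hev' : ∀ᶠ y in nhds x, (y ∈ hull K ↔ y ∈ closure U) := by
    filter_upwards [hev] with y hy
    refine ⟨fun hyK => h.hull_subset_closure hK hyK, fun hyU => ?_⟩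
    rw [← h.cover] at hyU
    obtain ⟨L, hL, hyL⟩ := mem_iUnion₂.1 hyU
    by_cases hLK : L = K
    · rwa [← hLK]
    · exact absurd hyL (hy L hL hLK)
  rw [← hU]
  filter_upwards [eventually_eventually_nhds.2 hev'] with y hy
  rw [mem_interior_iff_mem_nhds, mem_interior_iff_mem_nhds]
  exact Filter.eventually_congr hy

theorem mem_frontier (h : IsTriangulation U T) (hU : interior (closure U) = U)
    (hK : K ∈ T) (hF : F ∈ facetsOf K) {x ν : Pt d} (hx : x ∈ core F)
    (hν : IsOuterNormalAt U x ν) : x ∈ frontier U := by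
  have hopen : IsOpen U := hU ▸ isOpen_interior
  rw [hopen.frontier_eq]
  exact ⟨h.hull_subset_closure hK
    (convexHull_mono (by exact_mod_cast subset_of_mem_facetsOf hF) hx.1), hν.notMem⟩

end IsTriangulation

/-! ### The two-subdomain mesh: interface facets and summation of fluxes. -/

/-- The opposite subdomain. -/
def Side.other : Side → Side
  | .s => .b
  | .b => .s

/-- The sign of the interface normal, seen from a subdomain. -/
def Side.sign : Side → ℝ
  | .s => 1
  | .b => -1

theorem Domains.isOpen_sub (D : Domains d) (j : Side) : IsOpen (D.sub j) :=
  D.sub_regular j ▸ isOpen_interior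

theorem Domains.disjoint_other (D : Domains d) (j : Side) :
    Disjoint (D.sub j) (D.sub j.other) := by
  cases j
  · exact D.sub_disjoint
  · exact D.sub_disjoint.symm

theorem Domains.closure_inter_subset (D : Domains d) :
    closure (D.sub .s) ∩ closure (D.sub .b) ⊆ D.GI := by
  rintro x ⟨hs, hb⟩
  rw [Domains.GI, (D.isOpen_sub .s).frontier_eq, (D.isOpen_sub .b).frontier_eq]
  exact ⟨⟨hs, fun h => (D.sub_disjoint.closure_right (D.isOpen_sub .s)).le_bot ⟨h, hb⟩⟩,
    ⟨hb, fun h => (D.sub_disjoint.closure_left (D.isOpen_sub .b)).le_bot ⟨hs, h⟩⟩⟩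

theorem mem_facets {T : Finset (Finset (Pt d))} {F : Finset (Pt d)} :
    F ∈ facets T ↔ ∃ K ∈ T, F ∈ facetsOf K := Finset.mem_biUnion

namespace IsMesh

variable {D : Domains d} {Tr : Side → Finset (Finset (Pt d))} {j : Side} {F : Finset (Pt d)}

theorem mem_union (hK : K ∈ Tr j) : K ∈ Tr .s ∪ Tr .b := by
  cases j
  · exact Finset.mem_union_left _ hK
  · exact Finset.mem_union_right _ hK

theorem isSimplex (h : IsMesh D Tr) (hK : K ∈ Tr j) : IsSimplex K := (h.sub j).isSimplex hK

theorem notMem_other (h : IsMesh D Tr) (hK : K ∈ Tr j) : K ∉ Tr j.other := by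
  intro hK'
  have h1 := interior_mono ((h.sub j).hull_subset_closure hK)
  have h2 := interior_mono ((h.sub j.other).hull_subset_closure hK')
  rw [D.sub_regular] at h1 h2
  obtain ⟨x, hx⟩ : (interior (hull K)).Nonempty := by
    rw [(h.isSimplex hK).hull_eq]
    exact interior_solid_nonempty _
  exact (D.disjoint_other j).le_bot ⟨h1 hx, h2 hx⟩

/-- Replaces the measure-theoretic definition of an interface facet by a combinatorial one. A facet
almost contained in the interface has a relative interior point there, since its measure is
positive. That point lies in an element of each subdomain, and conformity of the whole mesh makes
the facet one of theirs. -/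
theorem mem_facetsI_iff (h : IsMesh D Tr) (hd : 0 < d) :
    F ∈ facetsI D Tr ↔ F ∈ facets (Tr .s) ∧ F ∈ facets (Tr .b) := by
  rw [facetsI, Finset.mem_filter, Finset.mem_union]
  constructor
  · rintro ⟨hF, hI⟩
    have key : ∀ j, F ∈ facets (Tr j) → ∀ j', F ∈ facets (Tr j') := by
      intro j hF j'
      obtain ⟨K, hK, hFK⟩ := mem_facets.1 hF
      have hs := h.isSimplex hK
      obtain ⟨x, hx, hxI⟩ : ∃ x ∈ core F, x ∈ D.GI := by
        by_contra hno
        push Not at hno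
        refine hs.measure_facet_ne_zero hd hFK (measure_mono_null ?_
          (measure_union_null hI (hs.measure_hull_diff_core hFK)))
        intro x hx
        by_cases hxc : x ∈ core F
        · exact Or.inl ⟨hx, hno x hxc⟩
        · exact Or.inr ⟨hx, hxc⟩
      have hxj : x ∈ closure (D.sub j') := by
        cases j'
        · exact frontier_subset_closure hxI.1
        · exact frontier_subset_closure hxI.2
      rw [← (h.sub j').cover] at hxj
      obtain ⟨L, hL, hxL⟩ := mem_iUnion₂.1 hxj
      exact mem_facets.2 ⟨L, hL,
        h.whole.mem_facetsOf_of_mem_core (mem_union hK) (mem_union hL) hFK hx hxL⟩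
    rcases hF with hF | hF
    · exact ⟨key _ hF _, key _ hF _⟩
    · exact ⟨key _ hF _, key _ hF _⟩
  · rintro ⟨hs, hb⟩
    refine ⟨Or.inl hs, ?_⟩
    obtain ⟨K, hK, hFK⟩ := mem_facets.1 hs
    obtain ⟨L, hL, hFL⟩ := mem_facets.1 hb
    have hsub : hull F ⊆ D.GI := fun x hx => D.closure_inter_subset
      ⟨(h.sub .s).hull_subset_closure hK
        (convexHull_mono (by exact_mod_cast subset_of_mem_facetsOf hFK) hx),
       (h.sub .b).hull_subset_closure hL
        (convexHull_mono (by exact_mod_cast subset_of_mem_facetsOf hFL) hx)⟩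
    rw [LiesOn, sdiff_eq_empty.2 hsub, measure_empty]

theorem mem_facetsI_iff' (h : IsMesh D Tr) (hd : 0 < d) (j : Side) :
    F ∈ facetsI D Tr ↔ F ∈ facets (Tr j) ∧ F ∈ facets (Tr j.other) := by
  cases j
  · exact h.mem_facetsI_iff hd
  · rw [h.mem_facetsI_iff hd]
    exact and_comm

/-- The element of a subdomain behind an interface facet is unique. -/
theorem eq_of_mem_facetsI (h : IsMesh D Tr) (hd : 0 < d) (hF : F ∈ facetsI D Tr) (hK : K ∈ Tr j)
    (hFK : F ∈ facetsOf K) : ∀ L ∈ Tr j, F ∈ facetsOf L → L = K := by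
  intro L hL hFL
  -- `M` lies on the other side of the interface. Two elements on this side together with `M` would
  -- be three at one facet of the whole mesh.
  obtain ⟨M, hM, hFM⟩ := mem_facets.1 ((h.mem_facetsI_iff' hd j).1 hF).2
  by_contra hLK
  rcases h.whole.eq_or_eq_of_mem_facetsOf hd (mem_union hL) (mem_union hK) (mem_union hM) hLK
    hFL hFK hFM with rfl | rfl
  · exact h.notMem_other hL hM
  · exact h.notMem_other hK hM

theorem isOuterNormalAt_of_mem_facetsI (h : IsMesh D Tr) (hd : 0 < d) (hF : F ∈ facetsI D Tr)
    (hK : K ∈ Tr j) (hFK : F ∈ facetsOf K) {x : Pt d} (hx : x ∈ core F) :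
    IsOuterNormalAt (D.sub j) x (cellNormal K x) :=
  (h.sub j).isOuterNormalAt hd (D.sub_regular j) hK hFK (h.eq_of_mem_facetsI hd hF hK hFK) hx

theorem isOuterNormalAt_interface (h : IsMesh D Tr) (hd : 0 < d) (hF : F ∈ facetsI D Tr)
    {x : Pt d} (hx : x ∈ core F) :
    IsOuterNormalAt (D.sub .s) x (outerNormal (D.sub .s) x) := by
  obtain ⟨K, hK, hFK⟩ := mem_facets.1 ((h.mem_facetsI_iff hd).1 hF).1
  have := h.isOuterNormalAt_of_mem_facetsI hd hF hK hFK hx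
  rwa [this.outerNormal_eq]

theorem cellNormal_interface (h : IsMesh D Tr) (hd : 0 < d) (hF : F ∈ facetsI D Tr)
    (hK : K ∈ Tr j) (hFK : F ∈ facetsOf K) {x : Pt d} (hx : x ∈ core F) :
    cellNormal K x = j.sign • outerNormal (D.sub .s) x := by
  have h1 := h.isOuterNormalAt_interface hd hF hx
  have h2 := h.isOuterNormalAt_of_mem_facetsI hd hF hK hFK hx
  cases j
  · rw [Side.sign, one_smul, h1.unique h2]
  · rw [Side.sign, neg_smul, one_smul]
    exact h1.eq_neg h2 D.sub_disjoint

theorem mem_GI_of_mem_core (h : IsMesh D Tr) (hd : 0 < d) (hF : F ∈ facetsI D Tr)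
    {x : Pt d} (hx : x ∈ core F) : x ∈ D.GI := by
  obtain ⟨hs, hb⟩ := (h.mem_facetsI_iff hd).1 hF
  obtain ⟨K, hK, hFK⟩ := mem_facets.1 hs
  obtain ⟨L, hL, hFL⟩ := mem_facets.1 hb
  exact D.closure_inter_subset
      ⟨(h.sub .s).hull_subset_closure hK
        (convexHull_mono (by exact_mod_cast subset_of_mem_facetsOf hFK) hx.1),
       (h.sub .b).hull_subset_closure hL
        (convexHull_mono (by exact_mod_cast subset_of_mem_facetsOf hFL) hx.1)⟩

/-- A facet of a single element that is not on the interface is on the outer boundary. -/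
theorem outer_of_unique (h : IsMesh D Tr) (hd : 0 < d) (hK : K ∈ Tr j) (hFK : F ∈ facetsOf K)
    (huniq : ∀ L ∈ Tr j, F ∈ facetsOf L → L = K) (hF : F ∉ facetsI D Tr) :
    LiesOn F (D.G j) ∧ ∀ x ∈ core F, IsOuterNormalAt D.Om x (cellNormal K x) := by
  have huniq' : ∀ L ∈ Tr .s ∪ Tr .b, F ∈ facetsOf L → L = K := by
    intro L hL hFL
    have hLj : L ∈ Tr j ∨ L ∈ Tr j.other := by
      rcases Finset.mem_union.1 hL with hL | hL <;> cases j <;> simp [Side.other, hL]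
    rcases hLj with hL | hL
    · exact huniq L hL hFL
    · exact absurd ((h.mem_facetsI_iff' hd j).2 ⟨mem_facets.2 ⟨K, hK, hFK⟩,
        mem_facets.2 ⟨L, hL, hFL⟩⟩) hF
  have hν : ∀ x ∈ core F, IsOuterNormalAt D.Om x (cellNormal K x) := fun x hx =>
    h.whole.isOuterNormalAt hd D.regular (mem_union hK) hFK huniq' hx
  refine ⟨measure_mono_null ?_ ((h.isSimplex hK).measure_hull_diff_core hFK), hν⟩
  rintro x ⟨hx, hxG⟩
  refine ⟨hx, fun hxc => hxG ⟨?_, ?_⟩⟩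
  · exact h.whole.mem_frontier D.regular (mem_union hK) hFK hxc (hν x hxc)
  · exact (h.sub j).mem_frontier (D.sub_regular j) hK hFK hxc
      ((h.sub j).isOuterNormalAt hd (D.sub_regular j) hK hFK huniq hxc)

/-- The sum of the boundary integrals of a flux that is single-valued on facets and vanishes on the
outer boundary is an interface integral. -/
theorem sum_bdryInt (h : IsMesh D Tr) (hd : 0 < d) (j : Side) (A : MeshFn d (Pt d))
    (hA : ∀ F ∈ facets (Tr j), LiesOn F (D.G j) → ∀ᵐ x ∂(μHE[d - 1]).restrict (hull F),
      ∀ n, IsOuterNormalAt D.Om x n → inner ℝ (A F x) n = 0) :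
    ∑ K ∈ Tr j, bdryInt K (fun F x => inner ℝ (A F x) (cellNormal K x))
      = ∑ F ∈ facetsI D Tr,
          j.sign * facetInt F fun x => inner ℝ (A F x) (outerNormal (D.sub .s) x) := by
  -- Regrouping by facets leaves one or two elements per facet: two opposite normals cancel, one
  -- element off the interface means the outer boundary, and an interface facet keeps its single
  -- term.
  have hswap : ∑ K ∈ Tr j, bdryInt K (fun F x => inner ℝ (A F x) (cellNormal K x))
      = ∑ F ∈ facets (Tr j), ∑ K ∈ (Tr j).filter (fun K => F ∈ facetsOf K),
          facetInt F fun x => inner ℝ (A F x) (cellNormal K x) := by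
    refine Finset.sum_comm' fun K F => ?_
    rw [Finset.mem_filter, mem_facets]
    exact ⟨fun hKF => ⟨hKF, K, hKF⟩, fun hKF => hKF.1⟩
  have hsubset : facetsI D Tr ⊆ facets (Tr j) := fun F hF => ((h.mem_facetsI_iff' hd j).1 hF).1
  rw [hswap, ← Finset.sum_subset_zero_on_sdiff hsubset (f := fun F =>
    j.sign * facetInt F fun x => inner ℝ (A F x) (outerNormal (D.sub .s) x))]
  · intro F hF
    rw [Finset.mem_sdiff] at hF
    obtain ⟨K, hK, hFK⟩ := mem_facets.1 hF.1
    have hs := h.isSimplex hK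
    by_cases huniq : ∀ L ∈ Tr j, F ∈ facetsOf L → L = K
    · have hone : (Tr j).filter (fun K => F ∈ facetsOf K) = {K} := by
        ext L
        rw [Finset.mem_filter, Finset.mem_singleton]
        exact ⟨fun hL => huniq L hL.1 hL.2, fun hL => hL ▸ ⟨hK, hFK⟩⟩
      rw [hone, Finset.sum_singleton]
      obtain ⟨hlies, hν⟩ := h.outer_of_unique hd hK hFK huniq hF.2
      refine integral_eq_zero_of_ae ?_
      filter_upwards [hA F hF.1 hlies, hs.ae_core hFK] with x hx hxc using hx _ (hν x hxc)
    · push Not at huniq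
      obtain ⟨L, hL, hFL, hLK⟩ := huniq
      have htwo : (Tr j).filter (fun K => F ∈ facetsOf K) = {K, L} := by
        ext M
        rw [Finset.mem_filter, Finset.mem_insert, Finset.mem_singleton]
        constructor
        · rintro ⟨hM, hFM⟩
          exact (h.sub j).eq_or_eq_of_mem_facetsOf hd hK hL hM hLK.symm hFK hFL hFM
        · rintro (rfl | rfl)
          · exact ⟨hK, hFK⟩
          · exact ⟨hL, hFL⟩
      rw [htwo, Finset.sum_pair hLK.symm, hs.facetInt_congr hFK (f := fun x =>
        inner ℝ (A F x) (cellNormal L x)) (g := fun x => -inner ℝ (A F x) (cellNormal K x))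
        fun x hx => by
          rw [(h.sub j).cellNormal_eq_neg hd hK hL hLK.symm hFK hFL hx, inner_neg_right]]
      simp only [facetInt, integral_neg, add_neg_cancel]
  · intro F hF
    obtain ⟨K, hK, hFK⟩ := mem_facets.1 (hsubset hF)
    have huniq := h.eq_of_mem_facetsI hd hF hK hFK
    have hone : (Tr j).filter (fun K => F ∈ facetsOf K) = {K} := by
      ext L
      rw [Finset.mem_filter, Finset.mem_singleton]
      exact ⟨fun hL => huniq L hL.1 hL.2, fun hL => hL ▸ ⟨hK, hFK⟩⟩
    rw [hone, Finset.sum_singleton, (h.isSimplex hK).facetInt_congr hFK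
      (f := fun x => inner ℝ (A F x) (cellNormal K x))
      (g := fun x => j.sign * inner ℝ (A F x) (outerNormal (D.sub .s) x))
      fun x hx => by rw [h.cellNormal_interface hd hF hK hFK hx, real_inner_smul_right]]
    exact (integral_const_mul _ _).symm

end IsMesh

/-! ### Calculus within a convex body -/

theorem pd_of_subset {D D' : Set (Pt d)} {f : Pt d → ℝ} {x : Pt d} (hsub : D ⊆ D')
    (hD : UniqueDiffWithinAt ℝ D x) (hf : DifferentiableWithinAt ℝ f D' x) (i : Fin d) :
    pd D f i x = pd D' f i x := by
  rw [pd, pd, fderivWithin_subset hsub hD hf]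

theorem pd_congr_of_mem_nhds {D D' : Set (Pt d)} {f g : Pt d → ℝ} {x : Pt d} (hD : D ∈ nhds x)
    (hD' : D' ∈ nhds x) (hfg : f =ᶠ[nhds x] g) (i : Fin d) : pd D f i x = pd D' g i x := by
  rw [pd, pd, fderivWithin_of_mem_nhds hD, fderivWithin_of_mem_nhds hD', hfg.fderiv_eq]

theorem continuousOn_pd {D : Set (Pt d)} (hD : UniqueDiffOn ℝ D) {f : Pt d → ℝ}
    (hf : ContDiffOn ℝ 1 f D) (i : Fin d) : ContinuousOn (pd D f i) D :=
  (hf.continuousOn_fderivWithin hD (by norm_num)).clm_apply continuousOn_const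

theorem contDiffOn_pd {D : Set (Pt d)} (hD : UniqueDiffOn ℝ D) {f : Pt d → ℝ}
    (hf : ContDiffOn ℝ 2 f D) (i : Fin d) : ContDiffOn ℝ 1 (pd D f i) D :=
  (hf.fderivWithin hD (m := 1) (by norm_num)).clm_apply contDiffOn_const

theorem pd_mul {D : Set (Pt d)} {f g : Pt d → ℝ} {x : Pt d} (hD : UniqueDiffWithinAt ℝ D x)
    (hf : DifferentiableWithinAt ℝ f D x) (hg : DifferentiableWithinAt ℝ g D x) (i : Fin d) :
    pd D (fun y => f y * g y) i x = f x * pd D g i x + pd D f i x * g x := by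
  rw [pd, fderivWithin_fun_mul hD hf hg]
  simp [pd, mul_comm]

theorem pd_sum {D : Set (Pt d)} {α : Type*} (s : Finset α) {f : α → Pt d → ℝ} {x : Pt d}
    (hD : UniqueDiffWithinAt ℝ D x) (hf : ∀ a ∈ s, DifferentiableWithinAt ℝ (f a) D x)
    (i : Fin d) : pd D (fun y => ∑ a ∈ s, f a y) i x = ∑ a ∈ s, pd D (f a) i x := by
  rw [pd, fderivWithin_fun_sum hD hf]
  simp [pd]

theorem contDiffOn_coord {D : Set (Pt d)} {n : ℕ∞} {w : Pt d → Pt d} (hw : ContDiffOn ℝ n w D)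
    (i : Fin d) : ContDiffOn ℝ n (fun x => w x i) D :=
  (EuclideanSpace.proj (𝕜 := ℝ) i).contDiff.comp_contDiffOn hw

theorem continuousOn_divg {D : Set (Pt d)} (hD : UniqueDiffOn ℝ D) {w : Pt d → Pt d}
    (hw : ∀ i, ContDiffOn ℝ 1 (fun x => w x i) D) : ContinuousOn (divg D w) D :=
  continuousOn_finsetSum _ fun i _ => continuousOn_pd hD (hw i) i

theorem continuousOn_vec {α : Type*} [TopologicalSpace α] {D : Set α} {w : α → Pt d}
    (hw : ∀ i, ContinuousOn (fun x => w x i) D) : ContinuousOn w D :=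
  (PiLp.continuous_toLp 2 _).comp_continuousOn (continuousOn_pi.2 hw)

theorem continuousOn_coord {α : Type*} [TopologicalSpace α] {D : Set α} {w : α → Pt d}
    (hw : ContinuousOn w D) (i : Fin d) : ContinuousOn (fun x => w x i) D :=
  (EuclideanSpace.proj (𝕜 := ℝ) i).continuous.comp_continuousOn hw

theorem continuousOn_mv {α : Type*} [TopologicalSpace α] {D : Set α}
    {S : α → Matrix (Fin d) (Fin d) ℝ} {w : α → Pt d} (hS : ∀ i l, ContinuousOn (fun x => S x i l) D)
    (hw : ContinuousOn w D) : ContinuousOn (fun x => mv (S x) (w x)) D :=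
  continuousOn_vec fun i => by
    simp only [mv]
    exact continuousOn_finsetSum _ fun l _ => (hS i l).fun_mul (continuousOn_coord hw l)

theorem IsPolyOn.contDiffOn {k : ℕ} {S : Set (Pt d)} {f : Pt d → ℝ} (hf : IsPolyOn k S f) :
    ContDiffOn ℝ 1 f S := by
  obtain ⟨q, -, hq⟩ := hf
  refine ContDiffOn.congr (ContDiff.contDiffOn ?_) hq
  clear hq
  induction q using MvPolynomial.induction_on with
  | C a => simpa using contDiff_const
  | add p q hp hq => simpa only [map_add] using hp.add hq
  | mul_X p n hp =>
    simp only [map_mul, MvPolynomial.eval_X]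
    exact hp.mul (EuclideanSpace.proj (𝕜 := ℝ) n).contDiff

/-! ### Algebra of matrix fields -/

theorem inner_eq_sum (v w : Pt d) : inner ℝ v w = ∑ i, v i * w i := by
  simp [PiLp.inner_apply, mul_comm]

theorem inner_mv_comm {M : Matrix (Fin d) (Fin d) ℝ} (hM : ∀ i l, M i l = M l i) (v w : Pt d) :
    inner ℝ (mv M v) w = inner ℝ (mv M w) v := by
  simp only [inner_eq_sum, mv, Finset.sum_mul]
  rw [Finset.sum_comm]
  refine Finset.sum_congr rfl fun i _ => Finset.sum_congr rfl fun l _ => ?_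
  rw [hM]; ring

theorem mv_sub (M : Matrix (Fin d) (Fin d) ℝ) (v w : Pt d) : mv M (v - w) = mv M v - mv M w := by
  ext i
  simp [mv, mul_sub, Finset.sum_sub_distrib]

theorem eps_symm (D : Set (Pt d)) (w : Pt d → Pt d) (x : Pt d) (i l : Fin d) :
    eps D w x i l = eps D w x l i := by
  simp [eps, add_comm]

theorem stress_symm (D : Set (Pt d)) (μ : ℝ) (w : Pt d → Pt d) (q : Pt d → ℝ) (x : Pt d)
    (i l : Fin d) : stress D μ w q x i l = stress D μ w q x l i := by
  simp [stress, eps_symm D w x i l, Matrix.one_apply, eq_comm]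

theorem mv_stress (D : Set (Pt d)) (μ : ℝ) (w : Pt d → Pt d) (q : Pt d → ℝ) (x n : Pt d) :
    mv (stress D μ w q x) n = (2 * μ) • mv (eps D w x) n - q x • n := by
  ext i
  simp [mv, stress, sub_mul, Finset.sum_sub_distrib, Finset.mul_sum, mul_assoc, Matrix.one_apply]

/-- `σ : ∇ v = 2 μ ε(w) : ε(v) - q ∇ · v`. -/
theorem sum_stress_mul_pd (D D' : Set (Pt d)) (μ : ℝ) (w v : Pt d → Pt d) (q : Pt d → ℝ) (x : Pt d) :
    ∑ i, ∑ l, stress D μ w q x i l * pd D' (fun y => v y i) l x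
      = 2 * μ * frob (eps D w x) (eps D' v x) - q x * divg D' v x := by
  have h1 : ∑ i, ∑ l, eps D w x i l * pd D' (fun y => v y i) l x
      = frob (eps D w x) (eps D' v x) := by
    have h2 : ∑ i, ∑ l, eps D w x i l * pd D' (fun y => v y i) l x
        = ∑ i, ∑ l, eps D w x i l * pd D' (fun y => v y l) i x := by
      rw [Finset.sum_comm]
      refine Finset.sum_congr rfl fun i _ => Finset.sum_congr rfl fun l _ => ?_
      rw [eps_symm]
    have h3 : frob (eps D w x) (eps D' v x)
        = (∑ i, ∑ l, eps D w x i l * pd D' (fun y => v y i) l x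
          + ∑ i, ∑ l, eps D w x i l * pd D' (fun y => v y l) i x) / 2 := by
      rw [frob, ← Finset.sum_add_distrib, Finset.sum_div]
      refine Finset.sum_congr rfl fun i _ => ?_
      rw [← Finset.sum_add_distrib, Finset.sum_div]
      refine Finset.sum_congr rfl fun l _ => ?_
      simp only [eps, Matrix.of_apply]
      ring
    rw [h3, ← h2]; ring
  rw [← h1, divg, Finset.mul_sum, Finset.mul_sum, ← Finset.sum_sub_distrib]
  refine Finset.sum_congr rfl fun i _ => ?_
  simp [stress, sub_mul, Finset.sum_sub_distrib, Finset.mul_sum, mul_assoc, Matrix.one_apply]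

/-! ### Integrals over one element -/

theorem IsSimplex.uniqueDiffOn (h : IsSimplex K) : UniqueDiffOn ℝ (hull K) := by
  rw [h.hull_eq]; exact uniqueDiffOn_solid _

/-- The boundary of a convex set is null. This is what makes the differential equations, imposed
only in the open subdomains, sufficient under the integrals. -/
theorem cellInt_congr {f g : Pt d → ℝ} (hfg : ∀ x ∈ interior (hull K), f x = g x) :
    cellInt K f = cellInt K g := by
  have hconv : Convex ℝ (hull K) := convex_convexHull ℝ _
  have hnull := hconv.addHaar_frontier volume
  refine setIntegral_congr_ae (measurableSet_hull K) ?_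
  have : ∀ᵐ x : Pt d, x ∉ frontier (hull K) := measure_eq_zero_iff_ae_notMem.1 hnull
  filter_upwards [this] with x hx hxK
  refine hfg x ?_
  by_contra hint
  exact hx ⟨subset_closure hxK, hint⟩

theorem cellInt_add {f g : Pt d → ℝ} (hf : ContinuousOn f (hull K)) (hg : ContinuousOn g (hull K)) :
    cellInt K (fun x => f x + g x) = cellInt K f + cellInt K g :=
  integral_add (hf.integrableOn_compact (isCompact_hull K))
    (hg.integrableOn_compact (isCompact_hull K))

theorem IsSimplex.facetInt_add (h : IsSimplex K) (hd : 0 < d) {F : Finset (Pt d)}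
    (hF : F ∈ facetsOf K) {f g : Pt d → ℝ} (hf : ContinuousOn f (hull F))
    (hg : ContinuousOn g (hull F)) :
    facetInt F (fun x => f x + g x) = facetInt F f + facetInt F g :=
  integral_add (h.integrableOn_facet hd hF hf) (h.integrableOn_facet hd hF hg)

/-- The flux through the boundary of `K` is additive. -/
theorem IsSimplex.bdryInt_add (h : IsSimplex K) (hd : 0 < d) {V W : MeshFn d (Pt d)}
    (hV : ∀ F ∈ facetsOf K, ContinuousOn (V F) (hull F))
    (hW : ∀ F ∈ facetsOf K, ContinuousOn (W F) (hull F)) :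
    bdryInt K (fun F x => inner ℝ (V F x + W F x) (cellNormal K x))
      = bdryInt K (fun F x => inner ℝ (V F x) (cellNormal K x))
        + bdryInt K (fun F x => inner ℝ (W F x) (cellNormal K x)) := by
  rw [bdryInt, bdryInt, bdryInt, ← Finset.sum_add_distrib]
  refine Finset.sum_congr rfl fun F hF => ?_
  -- The normal is first replaced by its constant value on the facet, which makes the integrands
  -- continuous and hence integrable.
  obtain ⟨v, rfl⟩ := h.exists_of_mem_facetsOf hF
  rw [h.facetInt_inner_normal hd, h.facetInt_inner_normal hd, h.facetInt_inner_normal hd]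
  simp only [inner_add_left]
  exact h.facetInt_add hd hF ((hV _ hF).inner continuousOn_const)
    ((hW _ hF).inner continuousOn_const)

/-- Integration by parts for a matrix field. -/
theorem IsSimplex.cellInt_sum_mul_pd (h : IsSimplex K) (hd : 0 < d)
    {S : Pt d → Matrix (Fin d) (Fin d) ℝ} {v : Pt d → Pt d}
    (hS : ∀ i l, ContDiffOn ℝ 1 (fun x => S x i l) (hull K))
    (hsymm : ∀ x i l, S x i l = S x l i)
    (hv : ∀ i, ContDiffOn ℝ 1 (fun x => v x i) (hull K)) :
    cellInt K (fun x => ∑ i, ∑ l, S x i l * pd (hull K) (fun y => v y i) l x)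
      = cellInt K (fun x => inner ℝ (-matDiv (hull K) S x) (v x))
        + bdryInt K fun _ x => inner ℝ (mv (S x) (v x)) (cellNormal K x) := by
  have hw : ∀ l, ContDiffOn ℝ 1 (fun x => (mv (S x) (v x)) l) (hull K) := fun l => by
    simp only [mv]
    exact ContDiffOn.sum fun i _ => (hS l i).mul (hv i)
  rw [← h.cellInt_divg hd hw, ← cellInt_add]
  · refine cellInt_congr fun x hx => ?_
    have hxK := interior_subset hx
    have hu := h.uniqueDiffOn x hxK
    have hdS := fun i l => (hS i l).differentiableOn (by norm_num) x hxK
    have hdv := fun i => (hv i).differentiableOn (by norm_num) x hxK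
    have hdiv : divg (hull K) (fun x => mv (S x) (v x)) x
        = ∑ l, ∑ i, (S x l i * pd (hull K) (fun y => v y i) l x
            + pd (hull K) (fun y => S y l i) l x * v x i) := by
      rw [divg]
      refine Finset.sum_congr rfl fun l _ => ?_
      simp only [mv]
      rw [pd_sum _ hu fun i _ => (hdS l i).fun_mul (hdv i)]
      exact Finset.sum_congr rfl fun i _ => pd_mul hu (hdS l i) (hdv i) l
    rw [hdiv, inner_neg_left, inner_eq_sum]
    simp only [matDiv, Finset.sum_mul, Finset.sum_add_distrib]
    have hS' : ∑ l, ∑ i, pd (hull K) (fun y => S y l i) l x * v x i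
        = ∑ i, ∑ l, pd (hull K) (fun y => S y i l) l x * v x i := by
      rw [Finset.sum_comm]
      simp only [hsymm]
    have hS'' : ∑ l, ∑ i, S x l i * pd (hull K) (fun y => v y i) l x
        = ∑ i, ∑ l, S x i l * pd (hull K) (fun y => v y i) l x := by
      rw [Finset.sum_comm]
      exact Finset.sum_congr rfl fun i _ => Finset.sum_congr rfl fun l _ => by rw [hsymm]
    rw [hS', hS'']
    ring
  · refine ContinuousOn.inner (continuousOn_vec fun i => ?_) (continuousOn_vec fun i =>
      (hv i).continuousOn)
    simp only [matDiv, PiLp.neg_apply]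
    exact (continuousOn_finsetSum _ fun l _ => continuousOn_pd h.uniqueDiffOn (hS i l) l).fun_neg
  · exact continuousOn_divg h.uniqueDiffOn hw

theorem hull_mono_of_mem_facetsOf {K F : Finset (Pt d)} (hF : F ∈ facetsOf K) :
    hull F ⊆ hull K :=
  convexHull_mono (by exact_mod_cast subset_of_mem_facetsOf hF)

theorem ae_mem_of_liesOn {F : Finset (Pt d)} {S : Set (Pt d)} (h : LiesOn F S) :
    ∀ᵐ x ∂(μHE[d - 1]).restrict (hull F), x ∈ S := by
  rw [ae_iff, Measure.restrict_apply₀' (measurableSet_hull F).nullMeasurableSet, inter_comm]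
  exact h

theorem bdryInt_congr {K : Finset (Pt d)} {f g : MeshFn d ℝ}
    (hfg : ∀ F ∈ facetsOf K, ∀ x ∈ hull F, f F x = g F x) : bdryInt K f = bdryInt K g :=
  Finset.sum_congr rfl fun F hF => setIntegral_congr_fun (measurableSet_hull F) (hfg F hF)

theorem bdryInt_eq_zero {K : Finset (Pt d)} {f : MeshFn d ℝ}
    (hf : ∀ F ∈ facetsOf K, ∀ x ∈ hull F, f F x = 0) : bdryInt K f = 0 := by
  rw [bdryInt_congr (g := fun _ _ => 0) hf]
  simp [bdryInt, facetInt]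

/-! ### The exact solution on the elements of one subdomain. -/

/-- The stress of the exact solution in one subdomain. -/
def exactStress (P : Coeff) (D : Domains d) (u : Side → ℝ → Pt d → Pt d) (p : Side → ℝ → Pt d → ℝ)
    (j : Side) (t : ℝ) : Pt d → Matrix (Fin d) (Fin d) ℝ :=
  stress (closure (D.sub j)) (P.mu j) (u j t) (p j t)

section Solution

variable {D : Domains d} {Tr : Side → Finset (Finset (Pt d))} {P : Coeff} {T : ℝ}
  {f : Side → ℝ → Pt d → Pt d} {g : ℝ → Pt d → ℝ}
  {u : Side → ℝ → Pt d → Pt d} {p : Side → ℝ → Pt d → ℝ}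
  {z : ℝ → Pt d → Pt d} {pp : ℝ → Pt d → ℝ} {t : ℝ} {j : Side} {F : Finset (Pt d)}

theorem IsMesh.glue_eq (h : IsMesh D Tr) (hK : K ∈ Tr j) {α : Type*} (w : Side → Pt d → α) :
    glue Tr w K = w j := by
  cases j
  · simp [glue, hK]
  · have : K ∉ Tr .s := h.notMem_other hK
    simp [glue, this]

theorem IsMesh.hull_subset (h : IsMesh D Tr) (hK : K ∈ Tr j) : hull K ⊆ closure (D.sub j) :=
  (h.sub j).hull_subset_closure hK

theorem IsMesh.interior_subset_sub (h : IsMesh D Tr) (hK : K ∈ Tr j) :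
    interior (hull K) ⊆ D.sub j := by
  rw [← D.sub_regular j]
  exact interior_mono (h.hull_subset hK)

theorem closure_sub_mem_nhds {x : Pt d} (hx : x ∈ D.sub j) : closure (D.sub j) ∈ nhds x :=
  Filter.mem_of_superset ((D.isOpen_sub j).mem_nhds hx) subset_closure

/-- Derivatives within an element and within its subdomain agree in the interior. -/
theorem IsMesh.pd_eq (h : IsMesh D Tr) (hK : K ∈ Tr j) {x : Pt d} (hx : x ∈ interior (hull K))
    (w : Pt d → ℝ) (i : Fin d) : pd (hull K) w i x = pd (closure (D.sub j)) w i x :=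
  pd_congr_of_mem_nhds (mem_interior_iff_mem_nhds.1 hx)
    (closure_sub_mem_nhds (h.interior_subset_sub hK hx)) Filter.EventuallyEq.rfl i

theorem IsMesh.divg_eq (h : IsMesh D Tr) (hK : K ∈ Tr j) {x : Pt d} (hx : x ∈ interior (hull K))
    (w : Pt d → Pt d) : divg (hull K) w x = divg (closure (D.sub j)) w x := by
  simp only [divg, h.pd_eq hK hx]

/-- Boundary points of the element are included, since the form also integrates `ε(u) n` over
facets. There the derivatives agree because `w` is differentiable within the larger set and the
element determines derivatives uniquely. -/
theorem IsMesh.eps_eq (h : IsMesh D Tr) (hK : K ∈ Tr j) {w : Pt d → Pt d}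
    (hw : ContDiffOn ℝ 2 w (closure (D.sub j))) {x : Pt d} (hx : x ∈ hull K) :
    eps (hull K) w x = eps (closure (D.sub j)) w x := by
  have hd := fun i => (contDiffOn_coord (n := 2) hw i).differentiableOn (by norm_num) x
    (h.hull_subset hK hx)
  have hu := (h.isSimplex hK).uniqueDiffOn x hx
  ext i l
  simp only [eps, Matrix.of_apply, pd_of_subset (h.hull_subset hK) hu (hd _)]

/-- The derivatives are rewritten within the convex element, where unique differentiability is
available and the derivative of a C² function is therefore C¹. -/
theorem IsSmoothSolution.contDiffOn_stress (hsol : IsSmoothSolution P D T f g u p z pp)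
    (h : IsMesh D Tr) (ht : t ∈ Ioc 0 T) (hK : K ∈ Tr j)
    (i l : Fin d) : ContDiffOn ℝ 1 (fun x => exactStress P D u p j t x i l) (hull K) := by
  have hu2 := fun i => contDiffOn_coord (n := 2) ((hsol.u_smooth j t ht).mono (h.hull_subset hK)) i
  have hU := (h.isSimplex hK).uniqueDiffOn
  have h1 : ContDiffOn ℝ 1 (fun x => (2 * P.mu j) *
      ((pd (hull K) (fun y => u j t y i) l x + pd (hull K) (fun y => u j t y l) i x) / 2)
      - p j t x * (1 : Matrix (Fin d) (Fin d) ℝ) i l) (hull K) :=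
    (contDiffOn_const.mul (((contDiffOn_pd hU (hu2 i) l).add
      (contDiffOn_pd hU (hu2 l) i)).div_const 2)).sub
      (((hsol.p_smooth j t ht).mono (h.hull_subset hK)).mul contDiffOn_const)
  refine h1.congr fun x hx => ?_
  have := h.eps_eq hK (hsol.u_smooth j t ht) hx
  rw [exactStress, stress, ← this]
  simp [eps]

theorem IsSmoothSolution.neg_matDiv_stress (hsol : IsSmoothSolution P D T f g u p z pp)
    (h : IsMesh D Tr) (ht : t ∈ Ioc 0 T) (hK : K ∈ Tr j)
    {x : Pt d} (hx : x ∈ interior (hull K)) :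
    -matDiv (hull K) (exactStress P D u p j t) x = f j t x := by
  rw [← hsol.momentum j t ht x (h.interior_subset_sub hK hx)]
  simp only [matDiv, h.pd_eq hK hx, exactStress]

/-- The momentum equation, tested on one subdomain. -/
theorem IsSmoothSolution.momentum_side (hsol : IsSmoothSolution P D T f g u p z pp)
    (h : IsMesh D Tr) (hd : 0 < d) (ht : t ∈ Ioc 0 T) (β : ℝ)
    {U : MeshFn d (Pt d)} {Q : MeshFn d ℝ} (hU : ∀ K ∈ Tr j, U K = u j t)
    (hQ : ∀ K ∈ Tr j, Q K = p j t) {v vb : MeshFn d (Pt d)}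
    (hv : ∀ K ∈ Tr j, ∀ i, ContDiffOn ℝ 1 (fun x => v K x i) (hull K))
    (hvb : ∀ F ∈ facets (Tr j), ContinuousOn (vb F) (hull F)) :
    ahj (Tr j) (P.mu j) β U (restrict (u j t)) v vb + bhj (Tr j) Q (restrict (p j t)) v vb
      = (∑ K ∈ Tr j, cellInt K fun x => inner ℝ (f j t x) (v K x))
        + ∑ K ∈ Tr j, bdryInt K fun F x =>
            inner ℝ (mv (exactStress P D u p j t x) (vb F x)) (cellNormal K x) := by
  rw [ahj, bhj, ← Finset.sum_neg_distrib, ← Finset.sum_add_distrib, ← Finset.sum_sub_distrib,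
    ← Finset.sum_sub_distrib, ← Finset.sum_add_distrib, ← Finset.sum_add_distrib,
    ← Finset.sum_add_distrib]
  refine Finset.sum_congr rfl fun K hK => ?_
  have hs := h.isSimplex hK
  have hsub := h.hull_subset hK
  set S := exactStress P D u p j t with hS
  have hS1 := fun i l => hsol.contDiffOn_stress h ht hK i l
  have hSsymm : ∀ x i l, S x i l = S x l i := fun x i l => stress_symm _ _ _ _ _ _ _
  have hp : ContinuousOn (p j t) (hull K) := (hsol.p_smooth j t ht).continuousOn.mono hsub
  have hvc : ContinuousOn (v K) (hull K) := continuousOn_vec fun i => (hv K hK i).continuousOn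
  have hFsub := fun F (hF : F ∈ facetsOf K) => hull_mono_of_mem_facetsOf hF
  have hvbF := fun F (hF : F ∈ facetsOf K) => hvb F (mem_facets.2 ⟨K, hK, hF⟩)
  have hSF := fun F (hF : F ∈ facetsOf K) i l => (hS1 i l).continuousOn.mono (hFsub F hF)
  have hvF := fun F (hF : F ∈ facetsOf K) => hvc.mono (hFsub F hF)
  have hpF := fun F (hF : F ∈ facetsOf K) => hp.mono (hFsub F hF)
  have hdivv : ContinuousOn (divg (hull K) (v K)) (hull K) :=
    continuousOn_divg hs.uniqueDiffOn (hv K hK)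
  rw [hU K hK, hQ K hK]
  have e1 : cellInt K (fun x => 2 * P.mu j * frob (eps (hull K) (u j t) x) (eps (hull K) (v K) x))
      = cellInt K (fun x => ∑ i, ∑ l, S x i l * pd (hull K) (fun y => v K y i) l x)
        + cellInt K (fun x => p j t x * divg (hull K) (v K) x) := by
    rw [← cellInt_add]
    · refine cellInt_congr fun x hx => ?_
      rw [h.eps_eq hK (hsol.u_smooth j t ht) (interior_subset hx), hS, exactStress,
        sum_stress_mul_pd]
      ring
    · exact continuousOn_finsetSum _ fun i _ => continuousOn_finsetSum _ fun l _ =>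
        (hS1 i l).continuousOn.fun_mul (continuousOn_pd hs.uniqueDiffOn (hv K hK i) l)
    · exact hp.mul hdivv
  have e2 : bdryInt K (fun F x => 2 * β * P.mu j * (Metric.diam (hull K))⁻¹ *
      inner ℝ (u j t x - restrict (u j t) F x) (v K x - vb F x)) = 0 :=
    bdryInt_eq_zero fun F _ x _ => by simp [restrict]
  have e4 : bdryInt K (fun F x => inner ℝ ((2 * P.mu j) • mv (eps (hull K) (v K) x)
      (cellNormal K x)) (u j t x - restrict (u j t) F x)) = 0 :=
    bdryInt_eq_zero fun F _ x _ => by simp [restrict]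
  -- Here `2μ ε(u) n = σ n + p n`. The `p n` part cancels the facet term of the pressure form, and
  -- symmetry moves `σ` onto `v - v̄`.
  have e3 : bdryInt K (fun F x => inner ℝ ((2 * P.mu j) • mv (eps (hull K) (u j t) x)
        (cellNormal K x)) (v K x - vb F x))
      = bdryInt K (fun F x => inner ℝ (mv (S x) (v K x - vb F x)) (cellNormal K x))
        + bdryInt K (fun F x => inner ℝ (p j t x • (v K x - vb F x)) (cellNormal K x)) := by
    rw [← hs.bdryInt_add hd
      (V := fun F x => mv (S x) (v K x - vb F x)) (W := fun F x => p j t x • (v K x - vb F x))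
      (fun F hF => continuousOn_mv (hSF F hF) ((hvF F hF).sub (hvbF F hF)))
      (fun F hF => (hpF F hF).smul ((hvF F hF).sub (hvbF F hF)))]
    refine bdryInt_congr fun F hF x hx => ?_
    rw [inner_add_left, inner_mv_comm (hSsymm x), hS, exactStress, mv_stress,
      h.eps_eq hK (hsol.u_smooth j t ht) (hFsub F hF hx), inner_sub_left, real_inner_smul_left,
      real_inner_smul_left, real_inner_smul_left, real_inner_comm (cellNormal K x)]
    ring
  have e5 : bdryInt K (fun F x => restrict (p j t) F x * inner ℝ (v K x - vb F x) (cellNormal K x))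
      = bdryInt K (fun F x => inner ℝ (p j t x • (v K x - vb F x)) (cellNormal K x)) :=
    bdryInt_congr fun F _ x _ => by rw [real_inner_smul_left, restrict]
  have e6 : bdryInt K (fun _ x => inner ℝ (mv (S x) (v K x)) (cellNormal K x))
      = bdryInt K (fun F x => inner ℝ (mv (S x) (v K x - vb F x)) (cellNormal K x))
        + bdryInt K (fun F x => inner ℝ (mv (S x) (vb F x)) (cellNormal K x)) := by
    rw [← hs.bdryInt_add hd
      (V := fun F x => mv (S x) (v K x - vb F x)) (W := fun F x => mv (S x) (vb F x))
      (fun F hF => continuousOn_mv (hSF F hF) ((hvF F hF).sub (hvbF F hF)))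
      (fun F hF => continuousOn_mv (hSF F hF) (hvbF F hF))]
    refine bdryInt_congr fun F hF x hx => ?_
    rw [mv_sub, sub_add_cancel]
  have e7 : cellInt K (fun x => inner ℝ (-matDiv (hull K) S x) (v K x))
      = cellInt K (fun x => inner ℝ (f j t x) (v K x)) :=
    cellInt_congr fun x hx => by rw [hS, hsol.neg_matDiv_stress h ht hK hx]
  rw [e2, e4, e1, e3, e5, hs.cellInt_sum_mul_pd hd hS1 hSsymm (hv K hK), e6, e7]
  ring

end Solution

theorem inner_tang {ν : Pt d} (hν : ‖ν‖ = 1) (a w : Pt d) :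
    inner ℝ (tang ν a) (tang ν w) = inner ℝ a w - inner ℝ a ν * inner ℝ w ν := by
  simp only [tang, inner_sub_left, inner_sub_right, real_inner_smul_left, real_inner_smul_right,
    real_inner_self_eq_norm_sq, hν, real_inner_comm w ν]
  ring

theorem continuousOn_tang {S : Set (Pt d)} {w : Pt d → Pt d} (hw : ContinuousOn w S) (ν : Pt d) :
    ContinuousOn (fun x => tang ν (w x)) S :=
  hw.fun_sub ((hw.inner continuousOn_const).fun_smul continuousOn_const)

theorem mv_zero (M : Matrix (Fin d) (Fin d) ℝ) : mv M 0 = 0 := by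
  ext i
  simp [mv]

theorem MemVbar.continuousOn {F : Finset (Pt d)} {T : Finset (Finset (Pt d))} {GD : Set (Pt d)} {k : ℕ}
    {vb : MeshFn d (Pt d)} (hvb : MemVbar T GD k vb) (hF : F ∈ facets T) :
    ContinuousOn (vb F) (hull F) :=
  continuousOn_vec fun i => ((hvb F hF).1 i).contDiffOn.continuousOn

/-! ### Interface conditions and the four discrete equations. -/

section Solution

variable {D : Domains d} {Tr : Side → Finset (Finset (Pt d))} {P : Coeff} {T : ℝ}
  {f : Side → ℝ → Pt d → Pt d} {g : ℝ → Pt d → ℝ}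
  {u : Side → ℝ → Pt d → Pt d} {p : Side → ℝ → Pt d → ℝ}
  {z : ℝ → Pt d → Pt d} {pp : ℝ → Pt d → ℝ} {t : ℝ} {j : Side} {F : Finset (Pt d)}

/-- The interface conditions, tested at one point. -/
theorem IsSmoothSolution.interface_balance (hsol : IsSmoothSolution P D T f g u p z pp)
    (ht : t ∈ Ioc 0 T) {x ν : Pt d} (hx : x ∈ D.GI)
    (hν : IsOuterNormalAt (D.sub .s) x ν) (vs vb : Pt d) :
    P.gam * Real.sqrt (P.mu .s / P.kappa) *
        inner ℝ (tang ν (u .s t x - dt T (fun s => u .b s x) t)) (tang ν (vs - vb))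
      + pp t x * inner ℝ (vs - vb) ν + inner ℝ (mv (exactStress P D u p .s t x) vs) ν
      = inner ℝ (mv (exactStress P D u p .b t x) vb) ν := by
  have h1 := hsol.interface_slip t ht x hx ν hν
  have h2 := hsol.interface_pressure t ht x hx ν hν
  have h3 := hsol.interface_stress t ht x hx ν hν
  have hsymm : ∀ j i l, exactStress P D u p j t x i l = exactStress P D u p j t x l i :=
    fun j i l => stress_symm _ _ _ _ _ _ _
  -- Stress continuity reduces the claim to testing one traction `σ n` with `w = vs - vb`. Its
  -- tangential part is minus the slip term and its normal component is `-pp`, so the three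
  -- contributions cancel.
  rw [inner_mv_comm (hsymm .s), inner_mv_comm (hsymm .b), exactStress, exactStress, ← h3,
    ← real_inner_smul_left, ← h1, ← h2, real_inner_smul_left, inner_tang hν.1]
  simp only [mv_stress, inner_sub_left, inner_sub_right, real_inner_smul_left,
    real_inner_self_eq_norm_sq, hν.1, real_inner_comm ν vs, real_inner_comm ν vb]
  ring

theorem IsSmoothSolution.interface_facet (hsol : IsSmoothSolution P D T f g u p z pp)
    (h : IsMesh D Tr) (hd : 0 < d) (ht : t ∈ Ioc 0 T)
    (hF : F ∈ facetsI D Tr) {vs vb : Pt d → Pt d} (hvs : ContinuousOn vs (hull F))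
    (hvb : ContinuousOn vb (hull F)) :
    (facetInt F fun x => P.gam * Real.sqrt (P.mu .s / P.kappa) *
        inner ℝ (tang (outerNormal (D.sub .s) x) (u .s t x - dt T (fun s => u .b s x) t))
          (tang (outerNormal (D.sub .s) x) (vs x - vb x)))
      + (facetInt F fun x => pp t x * inner ℝ (vs x - vb x) (outerNormal (D.sub .s) x))
      + (facetInt F fun x =>
          inner ℝ (mv (exactStress P D u p .s t x) (vs x)) (outerNormal (D.sub .s) x))
      = facetInt F fun x =>
          inner ℝ (mv (exactStress P D u p .b t x) (vb x)) (outerNormal (D.sub .s) x) := by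
  obtain ⟨hFs, hFb⟩ := (h.mem_facetsI_iff hd).1 hF
  obtain ⟨K, hK, hFK⟩ := mem_facets.1 hFs
  obtain ⟨L, hL, hFL⟩ := mem_facets.1 hFb
  have hs := h.isSimplex hK
  obtain ⟨v, rfl⟩ := hs.exists_of_mem_facetsOf hFK
  set ν := hs.normal v
  have hν : ∀ x ∈ core (K.erase v), outerNormal (D.sub .s) x = ν := fun x hx => by
    have := h.cellNormal_interface hd hF hK hFK hx
    rw [hs.cellNormal_eq hd hx, Side.sign, one_smul] at this
    exact this.symm
  have hsubs := (hull_mono_of_mem_facetsOf hFK).trans (h.hull_subset hK)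
  have hsubb := (hull_mono_of_mem_facetsOf hFL).trans (h.hull_subset hL)
  have hw := hvs.fun_sub hvb
  have hu : ContinuousOn (fun x => u .s t x - dt T (fun s => u .b s x) t) (hull (K.erase v)) :=
    ((hsol.u_smooth .s t ht).continuousOn.mono hsubs).sub ((hsol.dt_ub_cont t ht).mono hsubb)
  have hpp : ContinuousOn (pp t) (hull (K.erase v)) :=
    (hsol.pp_smooth t ht).continuousOn.mono hsubb
  have hσ : ∀ i l, ContinuousOn (fun x => exactStress P D u p .s t x i l) (hull (K.erase v)) :=
    fun i l => (hsol.contDiffOn_stress h ht hK i l).continuousOn.mono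
      (hull_mono_of_mem_facetsOf hFK)
  -- Freezing the normal at its almost everywhere value `ν` makes the three integrands continuous,
  -- so the integrals may be added before the pointwise identity is used.
  have hrep : ∀ φ : Pt d → Pt d → ℝ, facetInt (K.erase v)
      (fun x => φ (outerNormal (D.sub .s) x) x) = facetInt (K.erase v) (φ ν) := fun φ =>
    hs.facetInt_congr hFK fun x hx => by rw [hν x hx]
  set φ₁ : Pt d → Pt d → ℝ := fun n x => P.gam * Real.sqrt (P.mu .s / P.kappa) *
    inner ℝ (tang n (u .s t x - dt T (fun s => u .b s x) t)) (tang n (vs x - vb x))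
  set φ₂ : Pt d → Pt d → ℝ := fun n x => pp t x * inner ℝ (vs x - vb x) n
  set φ₃ : Pt d → Pt d → ℝ := fun n x => inner ℝ (mv (exactStress P D u p .s t x) (vs x)) n
  have hc₁ : ContinuousOn (φ₁ ν) (hull (K.erase v)) :=
    continuousOn_const.fun_mul ((continuousOn_tang hu ν).inner (continuousOn_tang hw ν))
  have hc₂ : ContinuousOn (φ₂ ν) (hull (K.erase v)) :=
    hpp.fun_mul (hw.inner continuousOn_const)
  have hc₃ : ContinuousOn (φ₃ ν) (hull (K.erase v)) :=
    (continuousOn_mv hσ hvs).inner continuousOn_const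
  refine ((congrArg₂ (· + ·) (congrArg₂ (· + ·) (hrep φ₁) (hrep φ₂)) (hrep φ₃)).trans ?_)
  rw [← hs.facetInt_add hd hFK hc₁ hc₂, ← hs.facetInt_add hd hFK (hc₁.fun_add hc₂) hc₃]
  refine hs.facetInt_congr hFK fun x hx => ?_
  have hout := h.isOuterNormalAt_interface hd hF hx
  rw [hν x hx] at hout ⊢
  exact hsol.interface_balance ht (h.mem_GI_of_mem_core hd hF hx) hout _ _

/-- The flux `σ v̄` has no normal component on the outer boundary: `v̄` vanishes on Dirichlet
facets, and on Neumann facets symmetry gives `(σ v̄) · n = (σ n) · v̄ = 0`. -/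
theorem IsSmoothSolution.sum_bdryInt_stress (hsol : IsSmoothSolution P D T f g u p z pp)
    (h : IsMesh D Tr) (hd : 0 < d) (ht : t ∈ Ioc 0 T)
    {k : ℕ} {vb : MeshFn d (Pt d)} (hvb : MemVbar (Tr j) (D.GD j) k vb) :
    ∑ K ∈ Tr j, bdryInt K (fun F x =>
        inner ℝ (mv (exactStress P D u p j t x) (vb F x)) (cellNormal K x))
      = ∑ F ∈ facetsI D Tr, j.sign * facetInt F fun x =>
          inner ℝ (mv (exactStress P D u p j t x) (vb F x)) (outerNormal (D.sub .s) x) := by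
  refine h.sum_bdryInt hd j (fun F x => mv (exactStress P D u p j t x) (vb F x)) fun F hF hlies => ?_
  rcases h.resolve_DN j F hF hlies with hD | hN
  · filter_upwards [ae_restrict_mem (measurableSet_hull F)] with x hx n _
    rw [(hvb F hF).2 hD x hx, mv_zero, inner_zero_left]
  · filter_upwards [ae_mem_of_liesOn hN] with x hx n hn
    rw [exactStress, inner_mv_comm (stress_symm _ _ _ _ _),
      hsol.bc_N j t ht x hx n hn, inner_zero_left]

/-- Consistency of the discrete momentum equation. -/
theorem IsSmoothSolution.consistent_momentum (hsol : IsSmoothSolution P D T f g u p z pp)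
    (h : IsMesh D Tr) (hd : 0 < d) (ht : t ∈ Ioc 0 T)
    (β : Side → ℝ) {k : ℕ} {v : MeshFn d (Pt d)} {vbar : Side → MeshFn d (Pt d)}
    (hv : MemV (Tr .s ∪ Tr .b) k v) (hvbar : ∀ j, MemVbar (Tr j) (D.GD j) k (vbar j)) :
    ah P Tr β (glue Tr fun j => u j t) (fun j => restrict (u j t)) v vbar
        + ahI P D Tr (restrict (u .s t)) (restrict fun x => dt T (fun s => u .b s x) t)
            (vbar .s) (vbar .b)
        + bh Tr (glue Tr fun j => p j t) (fun j => restrict (p j t)) v vbar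
        + bhI D Tr (restrict (pp t)) (vbar .s) (vbar .b)
      = (∑ K ∈ Tr .s, cellInt K fun x => inner ℝ (f .s t x) (v K x))
        + ∑ K ∈ Tr .b, cellInt K fun x => inner ℝ (f .b t x) (v K x) := by
  have hside := fun j => hsol.momentum_side (j := j) h hd ht (β j)
    (U := glue Tr fun j => u j t) (Q := glue Tr fun j => p j t) (v := v) (vb := vbar j)
    (fun K hK => h.glue_eq hK _) (fun K hK => h.glue_eq hK _)
    (fun K hK i => (hv K (IsMesh.mem_union hK) i).contDiffOn)
    (fun F hF => (hvbar j).continuousOn hF)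
  have hs := hside .s
  have hb := hside .b
  rw [hsol.sum_bdryInt_stress h hd ht (hvbar _)] at hs hb
  have hI : ahI P D Tr (restrict (u .s t)) (restrict fun x => dt T (fun s => u .b s x) t)
            (vbar .s) (vbar .b)
        + bhI D Tr (restrict (pp t)) (vbar .s) (vbar .b)
        + (∑ F ∈ facetsI D Tr, Side.s.sign * facetInt F fun x =>
          inner ℝ (mv (exactStress P D u p .s t x) (vbar .s F x)) (outerNormal (D.sub .s) x))
        + (∑ F ∈ facetsI D Tr, Side.b.sign * facetInt F fun x =>
          inner ℝ (mv (exactStress P D u p .b t x) (vbar .b F x)) (outerNormal (D.sub .s) x))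
        = 0 := by
    rw [ahI, bhI, ← Finset.sum_add_distrib, ← Finset.sum_add_distrib, ← Finset.sum_add_distrib]
    refine Finset.sum_eq_zero fun F hF => ?_
    have := hsol.interface_facet h hd ht hF
      ((hvbar .s).continuousOn ((h.mem_facetsI_iff hd).1 hF).1)
      ((hvbar .b).continuousOn ((h.mem_facetsI_iff hd).1 hF).2)
    simp only [restrict, Side.sign, one_mul, neg_mul]
    rw [this, add_neg_cancel]
  rw [ah, bh]
  linarith

/-- Consistency of the discrete incompressibility and total pressure equations. -/
theorem IsSmoothSolution.consistent_total_pressure (hsol : IsSmoothSolution P D T f g u p z pp)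
    (h : IsMesh D Tr) (ht : t ∈ Ioc 0 T)
    (q : MeshFn d ℝ) (qbar : Side → MeshFn d ℝ) :
    bh Tr q qbar (glue Tr fun j => u j t) (fun j => restrict (u j t))
      + ch P Tr (restrict (pp t)) (glue Tr fun j => p j t) q = 0 := by
  have hbdry : ∀ j, ∑ K ∈ Tr j, bdryInt K (fun F x => qbar j F x *
      inner ℝ (glue Tr (fun j => u j t) K x - restrict (u j t) F x) (cellNormal K x)) = 0 :=
    fun j => Finset.sum_eq_zero fun K hK => bdryInt_eq_zero fun F _ x _ => by
      rw [h.glue_eq hK, restrict, sub_self, inner_zero_left, mul_zero]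
  have hs : ∑ K ∈ Tr .s, cellInt K (fun x => q K x * divg (hull K) (glue Tr (fun j => u j t) K) x)
      = 0 := by
    refine Finset.sum_eq_zero fun K hK => ?_
    rw [cellInt_congr (g := fun _ => 0) fun x hx => ?_]
    · simp [cellInt]
    · rw [h.glue_eq hK, h.divg_eq hK hx,
        neg_eq_zero.1 (hsol.incompressible t ht x (h.interior_subset_sub hK hx)), mul_zero]
  have hb : ∑ K ∈ Tr .b, cellInt K (fun x => q K x * divg (hull K) (glue Tr (fun j => u j t) K) x)
      = ch P Tr (restrict (pp t)) (glue Tr fun j => p j t) q := by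
    refine Finset.sum_congr rfl fun K hK => cellInt_congr fun x hx => ?_
    have := hsol.total_pressure t ht x (h.interior_subset_sub hK hx)
    rw [h.glue_eq hK, h.glue_eq hK, h.divg_eq hK hx, restrict]
    linear_combination -q K x * this
  rw [bh, bhj, bhj, hbdry, hbdry, hs, hb]
  ring

/-- The flux is `q̄ z`: on the outer boundary either `q̄ = 0` or `z · n = 0`, and on the interface
`z · n = (uˢ - ∂ₜuᵇ) · n`. The minus sign appears because `n` points into the Biot side. -/
theorem IsSmoothSolution.sum_bdryInt_flux (hsol : IsSmoothSolution P D T f g u p z pp)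
    (h : IsMesh D Tr) (hd : 0 < d) (ht : t ∈ Ioc 0 T)
    {k : ℕ} {qbar : MeshFn d ℝ} (hq : MemQbar0 (Tr .b) D.GP k qbar) :
    ∑ K ∈ Tr .b, bdryInt K (fun F x => qbar F x * inner ℝ (z t x - 0) (cellNormal K x))
      = -bhI D Tr qbar (restrict (u .s t)) (restrict fun x => dt T (fun s => u .b s x) t) := by
  have hA := h.sum_bdryInt hd .b (fun F x => qbar F x • z t x) fun F hF hlies => by
    rcases h.resolve_PF F hF hlies with hP | hN
    · filter_upwards [ae_restrict_mem (measurableSet_hull F)] with x hx n _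
      rw [hq.2 F hF hP x hx, zero_smul, inner_zero_left]
    · filter_upwards [ae_mem_of_liesOn hN] with x hx n hn
      rw [real_inner_smul_left, hsol.bc_F t ht x hx n hn, mul_zero]
  simp only [real_inner_smul_left] at hA
  simp only [sub_zero]
  rw [hA, bhI, ← Finset.sum_neg_distrib]
  refine Finset.sum_congr rfl fun F hF => ?_
  rw [Side.sign, neg_mul, one_mul]
  obtain ⟨K, hK, hFK⟩ := mem_facets.1 ((h.mem_facetsI_iff hd).1 hF).1
  rw [(h.isSimplex hK).facetInt_congr hFK fun x hx => ?_]
  rw [restrict, restrict, inner_sub_left, hsol.interface_flux t ht x (h.mem_GI_of_mem_core hd hF hx)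
    _ (h.isOuterNormalAt_interface hd hF hx), inner_add_left, add_sub_cancel_left]

/-- Consistency of the discrete mass balance. -/
theorem IsSmoothSolution.consistent_mass (hsol : IsSmoothSolution P D T f g u p z pp)
    (h : IsMesh D Tr) (hd : 0 < d) (ht : t ∈ Ioc 0 T)
    {k : ℕ} {qp qbar : MeshFn d ℝ} (hqp : MemQ (Tr .b) k qp) (hq : MemQbar0 (Tr .b) D.GP k qbar) :
    (∑ K ∈ Tr .b, cellInt K fun x => P.c0 * dt T (fun s => pp s x) t * qp K x)
      + ch P Tr (restrict fun x => dt T (fun s => pp s x) t)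
          (dtFn T (fun t => glue Tr fun j => p j t) t) (fun K x => P.alpha * qp K x)
      - bhj (Tr .b) qp qbar (restrict (z t)) (fun _ _ => 0)
      - bhI D Tr qbar (restrict (u .s t)) (restrict fun x => dt T (fun s => u .b s x) t)
    = ∑ K ∈ Tr .b, cellInt K fun x => g t x * qp K x := by
  have hcell : ∑ K ∈ Tr .b, cellInt K (fun x => g t x * qp K x)
      = (∑ K ∈ Tr .b, cellInt K fun x => P.c0 * dt T (fun s => pp s x) t * qp K x)
        + ch P Tr (restrict fun x => dt T (fun s => pp s x) t)
          (dtFn T (fun t => glue Tr fun j => p j t) t) (fun K x => P.alpha * qp K x)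
        + ∑ K ∈ Tr .b, cellInt K fun x => qp K x * divg (hull K) (restrict (z t) K) x := by
    rw [ch, ← Finset.sum_add_distrib, ← Finset.sum_add_distrib]
    refine Finset.sum_congr rfl fun K hK => ?_
    have hsub := h.hull_subset hK
    have hqc : ContinuousOn (qp K) (hull K) := (hqp K hK).contDiffOn.continuousOn
    have hpp := (hsol.dt_pp_cont t ht).mono hsub
    have hpb := (hsol.dt_pb_cont t ht).mono hsub
    have hdt : dtFn T (fun t => glue Tr fun j => p j t) t K
        = fun x => dt T (fun s => p .b s x) t := by
      ext x
      simp only [dtFn, h.glue_eq hK]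
    have hz : ContinuousOn (divg (hull K) (z t)) (hull K) :=
      continuousOn_divg (h.isSimplex hK).uniqueDiffOn fun i =>
        contDiffOn_coord (n := 1) ((hsol.z_smooth t ht).mono hsub) i
    simp only [hdt, restrict]
    rw [← cellInt_add, ← cellInt_add]
    · refine cellInt_congr fun x hx => ?_
      rw [← hsol.mass t ht x (h.interior_subset_sub hK hx), h.divg_eq hK hx]
      ring
    · exact ((continuousOn_const.mul hpp).mul hqc).add ((continuousOn_const.mul
        ((continuousOn_const.mul hpp).sub hpb)).mul (continuousOn_const.mul hqc))
    · exact hqc.mul hz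
    · exact (continuousOn_const.mul hpp).mul hqc
    · exact (continuousOn_const.mul
        ((continuousOn_const.mul hpp).sub hpb)).mul (continuousOn_const.mul hqc)
  have hflux := hsol.sum_bdryInt_flux h hd ht hq
  rw [hcell, bhj]
  simp only [restrict] at hflux ⊢
  linarith

/-- Consistency of the discrete Darcy law. -/
theorem IsSmoothSolution.consistent_darcy (hsol : IsSmoothSolution P D T f g u p z pp)
    (h : IsMesh D Tr) (hd : 0 < d) (ht : t ∈ Ioc 0 T)
    {k : ℕ} {w : MeshFn d (Pt d)} (hw : MemV (Tr .b) k w) :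
    (∑ K ∈ Tr .b, cellInt K fun x => inner ℝ (P.kappa⁻¹ • z t x) (w K x))
      + bhj (Tr .b) (restrict (pp t)) (restrict (pp t)) w (fun _ _ => 0) = 0 := by
  rw [bhj, ← Finset.sum_neg_distrib, ← Finset.sum_add_distrib, ← Finset.sum_add_distrib]
  refine Finset.sum_eq_zero fun K hK => ?_
  have hs := h.isSimplex hK
  have hsub := h.hull_subset hK
  have hU := hs.uniqueDiffOn
  have hw1 := fun i => (hw K hK i).contDiffOn
  have hwc : ContinuousOn (w K) (hull K) := continuousOn_vec fun i => (hw1 i).continuousOn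
  have hpp := (hsol.pp_smooth t ht).mono hsub
  have hz : ContinuousOn (z t) (hull K) := (hsol.z_smooth t ht).continuousOn.mono hsub
  have hprod : ∀ i, ContDiffOn ℝ 1 (fun x => (pp t x • w K x) i) (hull K) := fun i => by
    simp only [PiLp.smul_apply, smul_eq_mul]
    exact hpp.mul (hw1 i)
  -- The facet pressure is the trace of `pp`, so the divergence theorem for `pp w` settles each
  -- element alone; no cancellation between elements is needed.
  have hbdry : bdryInt K (fun F x => restrict (pp t) F x * inner ℝ (w K x - 0) (cellNormal K x))
      = cellInt K (divg (hull K) fun x => pp t x • w K x) := by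
    rw [hs.cellInt_divg hd hprod]
    exact bdryInt_congr fun F _ x _ => by rw [sub_zero, real_inner_smul_left, restrict]
  have hcell : cellInt K (fun x => restrict (pp t) K x * divg (hull K) (w K) x)
      = cellInt K (fun x => inner ℝ (P.kappa⁻¹ • z t x) (w K x)
          + divg (hull K) (fun x => pp t x • w K x) x) := by
    refine cellInt_congr fun x hx => ?_
    have hxK := interior_subset hx
    have hdarcy := hsol.darcy t ht x (h.interior_subset_sub hK hx)
    have hdiv : divg (hull K) (fun x => pp t x • w K x) x
        = pp t x * divg (hull K) (w K) x + inner ℝ (grad (closure (D.sub .b)) (pp t) x) (w K x) := by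
      rw [divg, divg, inner_eq_sum, Finset.mul_sum, ← Finset.sum_add_distrib]
      refine Finset.sum_congr rfl fun i _ => ?_
      simp only [PiLp.smul_apply, smul_eq_mul, grad]
      rw [pd_mul (hU x hxK) (hpp.differentiableOn (by norm_num) x hxK)
        ((hw1 i).differentiableOn (by norm_num) x hxK), h.pd_eq hK hx (pp t)]
    have hin : inner ℝ (P.kappa⁻¹ • z t x) (w K x)
        + inner ℝ (grad (closure (D.sub .b)) (pp t) x) (w K x) = 0 := by
      rw [← inner_add_left, hdarcy, inner_zero_left]
    rw [hdiv, restrict]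
    linarith
  rw [hbdry, hcell, cellInt_add ((hz.fun_const_smul _).inner hwc) (continuousOn_divg hU hprod)]
  ring

end Solution

end StokesBiot

end

theorem mainTheorem6 {d : ℕ} (hd : d = 2 ∨ d = 3) {k : ℕ} (hk : 1 ≤ k)
    (P : StokesBiot.Coeff) (D : StokesBiot.Domains d)
    (Tr : StokesBiot.Side → Finset (Finset (StokesBiot.Pt d))) (hTr : StokesBiot.IsMesh D Tr)
    (β : StokesBiot.Side → ℝ) {T : ℝ} (hT : 0 < T)
    (f : StokesBiot.Side → ℝ → StokesBiot.Pt d → StokesBiot.Pt d)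
    (g : ℝ → StokesBiot.Pt d → ℝ)
    (u : StokesBiot.Side → ℝ → StokesBiot.Pt d → StokesBiot.Pt d)
    (p : StokesBiot.Side → ℝ → StokesBiot.Pt d → ℝ)
    (z : ℝ → StokesBiot.Pt d → StokesBiot.Pt d) (pp : ℝ → StokesBiot.Pt d → ℝ)
    (hsol : StokesBiot.IsSmoothSolution P D T f g u p z pp) :
    StokesBiot.SatisfiesSemidiscreteHDG P D Tr k β T f g
      (fun t => StokesBiot.glue Tr fun j => u j t) (fun j t => StokesBiot.restrict (u j t))
      (fun t => StokesBiot.glue Tr fun j => p j t) (fun j t => StokesBiot.restrict (p j t))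
      (fun t => StokesBiot.restrict (z t))
      (fun t => StokesBiot.restrict (pp t)) (fun t => StokesBiot.restrict (pp t)) := by
  have hd0 : 0 < d := by omega
  intro t ht v vbar q qbar w qp qpbar hv hvbar _ _ hw hqp hqpbar
  exact ⟨hsol.consistent_momentum hTr hd0 ht β hv hvbar,
    hsol.consistent_total_pressure hTr ht q qbar,
    hsol.consistent_mass hTr hd0 ht hqp hqpbar,
    hsol.consistent_darcy hTr hd0 ht hw⟩
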